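/- **Setting.** Let $p\ge 0$, $q\ge 1$, and let $f,g:\mathbb{R}^p\times\mathbb{R}^q\to\mathbb{R}$ be continuously differentiable, with $\nabla_y g$ differentiable. Let $y^*(x)=\arg\min_y g(x,y)$, $\Phi(x)=f(x,y^*(x))$ and $x^*\in\arg\min_x\Phi(x)$. The pair $(f,g)$ is in the class $\mathcal{F}_{scsc}$ with constants $L_x,L_{xy},L_y,\widetilde L_{xy},\widetilde L_y,\rho_{xy},\rho_{yy}\ge 0$ and $\mu_x,\mu_y>0$ if: $\nabla_x f$ is $L_x$-Lipschitz in $x$ and $L_{xy}$-Lipschitz in $y$; $\nabla_y f$ is $L_{xy}$-Lipschitz in $x$ and $L_y$-Lipschitz in $y$; $\nabla_y g$ is $\widetilde L_{xy}$-Lipschitz in $x$ and $\widetilde L_y$-Lipschitz in $y$; $\nabla_x\nabla_y g$ and $\nabla_y^2 g$ are $\rho_{xy}$- and $\rho_{yy}$-Lipschitz in $(x,y)$ (operator norm); $\Phi$ is $\mu_x$-strongly convex and every $g(x,\cdot)$ is $\mu_y$-strongly convex; and $\|x^*\|>0$. No bound on $\nabla_y f$ is assumed. Let $\epsilon>0$,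 $\kappa_y=\widetilde L_y/\mu_y$, $$\Delta^*=\|\nabla_y f(x^*,y^*(x^*))\|+\frac{\|x^*\|}{\mu_y}+\frac{\sqrt{\Phi(0)-\Phi(x^*)}}{\sqrt{\mu_x}\,\mu_y},$$ $$L_\Phi=L_x+\frac{2L_{xy}\widetilde L_{xy}}{\mu_y}+\frac{L_y\widetilde L_{xy}^2}{\mu_y^2}+\Big(\frac{\widetilde L_{xy}\rho_{yy}}{\mu_y^2}+\frac{\rho_{xy}}{\mu_y}\Big)\Big(1+\frac{\widetilde L_{xy}}{\mu_y}\Big)\Big[\|\nabla_y f(x^*,y^*(x^*))\|+3\Big(L_{xy}+\frac{L_y\widetilde L_{xy}}{\mu_y}\Big)\sqrt{\tfrac{2}{\mu_x}(\Phi(0)-\Phi(x^*))+\|x^*\|^2+\tfrac{\epsilon}{\mu_x}}\Big],$$ and $\kappa_x=L_\Phi/\mu_x$. **Algorithm (AccBiO).** Let $\lambda=4/(\sqrt{\widetilde L_y}+\sqrt{\mu_y})^2$ and $\theta=\max\{(1-\sqrt{\lambda\mu_y})^2,(1-\sqrt{\lambda\widetilde L_y})^2\}$. Start from $z_0=x_0=0$.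 For $k=0,1,\dots$: 1. with $y^0=s^0=0$, for $t=1,\dots,N$ put $y^t=s^{t-1}-\frac{1}{\widetilde L_y}\nabla_y g(x_k,s^{t-1})$ and $s^t=\frac{2\sqrt{\kappa_y}}{\sqrt{\kappa_y}+1}y^t-\frac{\sqrt{\kappa_y}-1}{\sqrt{\kappa_y}+1}y^{t-1}$; 2. with $v^0=v^1=0$, put $v^{t+1}=v^t-\lambda\big(\nabla_y^2g(x_k,y^N)v^t-\nabla_yf(x_k,y^N)\big)+\theta(v^t-v^{t-1})$ up to $v^M$; 3. put $G_k=\nabla_xf(x_k,y^N)-\nabla_x\nabla_yg(x_k,y^N)v^M$, $z_{k+1}=x_k-\frac1{L_\Phi}G_k$ and $x_{k+1}=\big(1+\frac{\sqrt{\kappa_x}-1}{\sqrt{\kappa_x}+1}\big)z_{k+1}-\frac{\sqrt{\kappa_x}-1}{\sqrt{\kappa_x}+1}z_k$. The cost of computing $z_K$ is $\tau(n_J+n_H)+n_G$, where $n_J,n_H,n_G$ are the numbers of Jacobian-vector products, Hessian-vector products and gradient evaluations made, and $\tau>0$ is a fixed constant. Let $\Lambda$ be the logarithm of $$2+\frac1{\mu_x}+\frac1{\mu_y}+\widetilde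 L_y+\rho_{xy}+\rho_{yy}+\|x^*\|+\|y^*(x^*)\|+\|\nabla_yf(x^*,y^*(x^*))\|+\Phi(0)-\Phi(x^*)+\epsilon+\frac1\epsilon .$$ **Theorem.** Fix $L_x,L_{xy},L_y,\widetilde L_{xy}$, $\tau>0$ and an upper bound $\bar\mu$ for $\mu_y$. There are constants $c_0,C>0$ that depend only on these (not on $p,q,f,g,\epsilon,\mu_x,\mu_y,\widetilde L_y,\rho_{xy},\rho_{yy}$) such that for all $(f,g)\in\mathcal{F}_{scsc}$ with $\mu_y\le\bar\mu$ and all $\epsilon>0$: * *(order of $L_\Phi$)* $L_\Phi\le C\,T$, where $T=\frac1{\mu_y^2}+\big(\frac{\rho_{yy}}{\mu_y^3}+\frac{\rho_{xy}}{\mu_y^2}\big)\big(\Delta^*+\frac{\sqrt\epsilon}{\sqrt{\mu_x}\mu_y}\big)$; if moreover $L_y,\widetilde L_{xy}>0$, then $T\le C\,L_\Phi$, so that $L_\Phi=\Theta(T)$; * *(convergence)* for all integers $N,M\ge c_0\sqrt{\kappa_y}\,\Lambda$: $\Phi$ is differentiable, $\|\nabla\Phi(x)-\nabla\Phi(x_k)\|\le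 L_\Phi\|x-x_k\|$ for all $k\ge0$ and $x\in\mathbb{R}^p$, and for all $K\ge 0$ $$\Phi(z_K)-\Phi(x^*)\le\Big(1-\frac1{\sqrt{\kappa_x}}\Big)^K\Big(\Phi(0)-\Phi(x^*)+\frac{\mu_x}2\|x^*\|^2\Big)+\frac\epsilon2;$$ * *(complexity)* with $N=M=\lceil c_0\sqrt{\kappa_y}\,\Lambda\rceil$ and a suitable $K$, AccBiO attains $\Phi(z_K)-\Phi(x^*)<\epsilon$ at a cost of at most $$C\,\Big(\sqrt{\frac{\widetilde L_y}{\mu_x\mu_y^3}}+\Big(\sqrt{\frac{\rho_{yy}\widetilde L_y}{\mu_x\mu_y^4}}+\sqrt{\frac{\rho_{xy}\widetilde L_y}{\mu_x\mu_y^3}}\Big)\sqrt{\Delta^*}\Big)\,\Lambda^2 .$$ -/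

import Mathlib

open Set

noncomputable section

namespace Bilevel

/-- The Euclidean space `ℝⁿ`. -/
abbrev Vec (n : ℕ) : Type := EuclideanSpace ℝ (Fin n)

/-! ### Derivatives of functions of two vector variables -/

/-- The partial gradient `∇ₓ f(x, y)`. -/
def gradX {p q : ℕ} (f : Vec p → Vec q → ℝ) (x : Vec p) (y : Vec q) : Vec p :=
  gradient (fun x' => f x' y) x

/-- The partial gradient `∇_y f(x, y)`. -/
def gradY {p q : ℕ} (f : Vec p → Vec q → ℝ) (x : Vec p) (y : Vec q) : Vec q :=
  gradient (fun y' => f x y') y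

/-- The Hessian `∇_y² g(x, y)`, the derivative of `∇_y g(x, ·)`. -/
def hessY {p q : ℕ} (g : Vec p → Vec q → ℝ) (x : Vec p) (y : Vec q) : Vec q →L[ℝ] Vec q :=
  fderiv ℝ (fun y' => gradY g x y') y

/-- The `p × q` matrix `∇ₓ∇_y g(x, y)`, whose entry `(i, j)` is `∂²g / ∂xᵢ∂yⱼ`. It is the transpose
of the derivative of `∇_y g(·, y)`, and it maps `ℝ^q` to `ℝ^p`. -/
def jacXY {p q : ℕ} (g : Vec p → Vec q → ℝ) (x : Vec p) (y : Vec q) : Vec q →L[ℝ] Vec p :=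
  ContinuousLinearMap.adjoint (fderiv ℝ (fun x' => gradY g x' y) x)

/-! ### The bilevel problem -/

/-- The lower-level solution `y*(x)`, a minimizer of `g(x, ·)`
(unique when `g(x, ·)` is strongly convex). -/
def lowerSol {p q : ℕ} (g : Vec p → Vec q → ℝ) (x : Vec p) : Vec q :=
  Classical.epsilon (fun y => IsMinOn (g x) univ y)

/-- The objective `Φ(x) = f(x, y*(x))`. -/
def Phi {p q : ℕ} (f g : Vec p → Vec q → ℝ) (x : Vec p) : ℝ :=
  f x (lowerSol g x)

/-- The Lipschitz constants `L_x, L_xy, L_y` (of `∇f`) and `L̃_xy` (of `∇_y g` in `x`). -/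
structure SmoothConsts where
  Lx : ℝ
  Lxy : ℝ
  Ly : ℝ
  tLxy : ℝ

/-- The smoothness constant `L̃_y` of `g(x, ·)`, the Lipschitz constants `ρ_xy, ρ_yy` of
`∇ₓ∇_y g, ∇_y² g`, and the moduli of strong convexity `μ_x` of `Φ` and `μ_y` of `g(x, ·)`. -/
structure CondParams where
  tLy : ℝ
  rhoxy : ℝ
  rhoyy : ℝ
  mux : ℝ
  muy : ℝ

/-- The Euclidean norm of `(x, y) ∈ ℝ^p × ℝ^q`. -/
def pairNorm {p q : ℕ} (x : Vec p) (y : Vec q) : ℝ := Real.sqrt (‖x‖ ^ 2 + ‖y‖ ^ 2)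

/-- `(f, g)` lies in the strongly-convex-strongly-convex class, and `xstar` is the nonzero
minimizer of `Φ`. -/
structure IsSCSC {p q : ℕ} (S : SmoothConsts) (c : CondParams)
    (f g : Vec p → Vec q → ℝ) (xstar : Vec p) : Prop where
  Lx_nonneg : 0 ≤ S.Lx
  Lxy_nonneg : 0 ≤ S.Lxy
  Ly_nonneg : 0 ≤ S.Ly
  tLxy_nonneg : 0 ≤ S.tLxy
  tLy_nonneg : 0 ≤ c.tLy
  rhoxy_nonneg : 0 ≤ c.rhoxy
  rhoyy_nonneg : 0 ≤ c.rhoyy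
  mux_pos : 0 < c.mux
  muy_pos : 0 < c.muy
  contDiff_f : ContDiff ℝ 1 (fun w : Vec p × Vec q => f w.1 w.2)
  contDiff_g : ContDiff ℝ 1 (fun w : Vec p × Vec q => g w.1 w.2)
  differentiable_gradY_g : Differentiable ℝ (fun w : Vec p × Vec q => gradY g w.1 w.2)
  gradX_f_lip_x : ∀ x₁ x₂ y, ‖gradX f x₁ y - gradX f x₂ y‖ ≤ S.Lx * ‖x₁ - x₂‖
  gradX_f_lip_y : ∀ x y₁ y₂, ‖gradX f x y₁ - gradX f x y₂‖ ≤ S.Lxy * ‖y₁ - y₂‖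
  gradY_f_lip_x : ∀ x₁ x₂ y, ‖gradY f x₁ y - gradY f x₂ y‖ ≤ S.Lxy * ‖x₁ - x₂‖
  gradY_f_lip_y : ∀ x y₁ y₂, ‖gradY f x y₁ - gradY f x y₂‖ ≤ S.Ly * ‖y₁ - y₂‖
  gradY_g_lip_x : ∀ x₁ x₂ y, ‖gradY g x₁ y - gradY g x₂ y‖ ≤ S.tLxy * ‖x₁ - x₂‖
  gradY_g_lip_y : ∀ x y₁ y₂, ‖gradY g x y₁ - gradY g x y₂‖ ≤ c.tLy * ‖y₁ - y₂‖
  jacXY_g_lip : ∀ x₁ x₂ y₁ y₂,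
    ‖jacXY g x₁ y₁ - jacXY g x₂ y₂‖ ≤ c.rhoxy * pairNorm (x₁ - x₂) (y₁ - y₂)
  hessY_g_lip : ∀ x₁ x₂ y₁ y₂,
    ‖hessY g x₁ y₁ - hessY g x₂ y₂‖ ≤ c.rhoyy * pairNorm (x₁ - x₂) (y₁ - y₂)
  strongConvex_g : ∀ x, StrongConvexOn univ c.muy (g x)
  strongConvex_Phi : StrongConvexOn univ c.mux (Phi f g)
  isMin_xstar : IsMinOn (Phi f g) univ xstar
  xstar_norm_pos : 0 < ‖xstar‖

/-! ### Oracle computations and their cost -/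

/-- The numbers of gradients, Jacobian-vector and Hessian-vector products that were evaluated. -/
structure OracleCount where
  nG : ℕ
  nJ : ℕ
  nH : ℕ

/-- A result, together with the number of oracle calls made to obtain it. -/
structure Counted (α : Type) where
  val : α
  count : OracleCount

instance : Monad Counted where
  pure a := ⟨a, ⟨0, 0, 0⟩⟩
  bind m k :=
    ⟨(k m.val).val, ⟨m.count.nG + (k m.val).count.nG, m.count.nJ + (k m.val).count.nJ,
      m.count.nH + (k m.val).count.nH⟩⟩

/-- Run `step` `n` times, starting from `a`. -/
def iter {α : Type} (step : α → Counted α) : ℕ → α → Counted α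
  | 0, a => pure a
  | n + 1, a => iter step n a >>= step

/-- One gradient evaluation `∇ₓ h(x, y)`. -/
def queryGradX {p q : ℕ} (h : Vec p → Vec q → ℝ) (x : Vec p) (y : Vec q) : Counted (Vec p) :=
  ⟨gradX h x y, ⟨1, 0, 0⟩⟩

/-- One gradient evaluation `∇_y h(x, y)`. -/
def queryGradY {p q : ℕ} (h : Vec p → Vec q → ℝ) (x : Vec p) (y : Vec q) : Counted (Vec q) :=
  ⟨gradY h x y, ⟨1, 0, 0⟩⟩

/-- One Jacobian-vector product `∇ₓ∇_y g(x, y) v`. -/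
def queryJac {p q : ℕ} (g : Vec p → Vec q → ℝ) (x : Vec p) (y v : Vec q) : Counted (Vec p) :=
  ⟨jacXY g x y v, ⟨0, 1, 0⟩⟩

/-- One Hessian-vector product `∇_y² g(x, y) v`. -/
def queryHess {p q : ℕ} (g : Vec p → Vec q → ℝ) (x : Vec p) (y v : Vec q) : Counted (Vec q) :=
  ⟨hessY g x y v, ⟨0, 0, 1⟩⟩

/-- The total cost `τ (n_J + n_H) + n_G`. -/
def OracleCount.total (τ : ℝ) (n : OracleCount) : ℝ :=
  τ * ((n.nJ : ℝ) + (n.nH : ℝ)) + (n.nG : ℝ)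

/-! ### The algorithm AccBiO -/

/-- The condition number `κ_y = L̃_y / μ_y` of the lower-level problem. -/
def CondParams.kappay (c : CondParams) : ℝ := c.tLy / c.muy

/-- The heavy-ball step size `λ`. -/
def CondParams.hbStep (c : CondParams) : ℝ :=
  4 / (Real.sqrt c.tLy + Real.sqrt c.muy) ^ 2

/-- The heavy-ball momentum `θ`. -/
def CondParams.hbMomentum (c : CondParams) : ℝ :=
  max ((1 - Real.sqrt (c.hbStep * c.muy)) ^ 2) ((1 - Real.sqrt (c.hbStep * c.tLy)) ^ 2)

/-- One step `(y^{t-1}, s^{t-1}) ↦ (y^t, s^t)` of accelerated gradient descent on `g(x, ·)`. -/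
def agdStep {p q : ℕ} (c : CondParams) (g : Vec p → Vec q → ℝ) (x : Vec p)
    (w : Vec q × Vec q) : Counted (Vec q × Vec q) := do
  let d ← queryGradY g x w.2
  let y := w.2 - (1 / c.tLy) • d
  let s := (2 * Real.sqrt c.kappay / (Real.sqrt c.kappay + 1)) • y
    - ((Real.sqrt c.kappay - 1) / (Real.sqrt c.kappay + 1)) • w.1
  pure (y, s)

/-- The output `y^N` of `N` steps of accelerated gradient descent from `y^0 = s^0 = 0`. -/
def agd {p q : ℕ} (c : CondParams) (g : Vec p → Vec q → ℝ) (x : Vec p) (N : ℕ) :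
    Counted (Vec q) := do
  let w ← iter (agdStep c g x) N (0, 0)
  pure w.1

/-- One heavy-ball step `(v^{t-1}, v^t) ↦ (v^t, v^{t+1})` on
`Q(v) = ½ vᵀ ∇_y² g(x, y) v - vᵀ b`, for which `∇Q(v) = ∇_y² g(x, y) v - b`. -/
def hbIter {p q : ℕ} (c : CondParams) (g : Vec p → Vec q → ℝ) (x : Vec p) (y b : Vec q)
    (w : Vec q × Vec q) : Counted (Vec q × Vec q) := do
  let h ← queryHess g x y w.2
  pure (w.2, w.2 - c.hbStep • (h - b) + c.hbMomentum • (w.2 - w.1))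

/-- The heavy-ball iterate `v^M`, from `v^0 = v^1 = 0`. As `v^1` is given, `v^M` is reached by
`M - 1` updates (none if `M = 0`). -/
def heavyBall {p q : ℕ} (c : CondParams) (g : Vec p → Vec q → ℝ) (x : Vec p) (y b : Vec q)
    (M : ℕ) : Counted (Vec q) := do
  let w ← iter (hbIter c g x y b) (M - 1) (0, 0)
  pure w.2

/-- The hypergradient estimate `G = ∇ₓ f(x, y^N) - ∇ₓ∇_y g(x, y^N) v^M`. -/
def hypergrad {p q : ℕ} (c : CondParams) (f g : Vec p → Vec q → ℝ) (N M : ℕ) (x : Vec p) :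
    Counted (Vec p) := do
  let y ← agd c g x N
  let b ← queryGradY f x y
  let v ← heavyBall c g x y b M
  let j ← queryJac g x y v
  let a ← queryGradX f x y
  pure (a - j)

/-- One outer iteration `(z_k, x_k) ↦ (z_{k+1}, x_{k+1})`, where `L` is the smoothness parameter
that the algorithm uses and `κ = L / μ_x`. -/
def outerStep {p q : ℕ} (c : CondParams) (f g : Vec p → Vec q → ℝ) (L : ℝ) (N M : ℕ)
    (w : Vec p × Vec p) : Counted (Vec p × Vec p) := do
  let G ← hypergrad c f g N M w.2
  let m := (Real.sqrt (L / c.mux) - 1) / (Real.sqrt (L / c.mux) + 1)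
  let z := w.2 - (1 / L) • G
  let x := (1 + m) • z - m • w.1
  pure (z, x)

/-- `K` outer iterations of AccBiO from `z_0 = x_0 = 0`; the value is `(z_K, x_K)`. -/
def accBiO {p q : ℕ} (c : CondParams) (f g : Vec p → Vec q → ℝ) (L : ℝ) (N M K : ℕ) :
    Counted (Vec p × Vec p) :=
  iter (outerStep c f g L N M) K (0, 0)

/-! ### The quantities in the bounds -/

/-- `Δ* = ‖∇_y f(x*, y*(x*))‖ + ‖x*‖ / μ_y + √(Φ(0) - Φ(x*)) / (√μ_x μ_y)`. -/
def DeltaStar {p q : ℕ} (c : CondParams) (f g : Vec p → Vec q → ℝ) (xstar : Vec p) : ℝ :=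
  ‖gradY f xstar (lowerSol g xstar)‖ + ‖xstar‖ / c.muy
    + Real.sqrt (Phi f g 0 - Phi f g xstar) / (Real.sqrt c.mux * c.muy)

/-- The smoothness parameter `L_Φ`. -/
def LPhi {p q : ℕ} (S : SmoothConsts) (c : CondParams) (f g : Vec p → Vec q → ℝ)
    (xstar : Vec p) (ε : ℝ) : ℝ :=
  S.Lx + 2 * S.Lxy * S.tLxy / c.muy + S.Ly * S.tLxy ^ 2 / c.muy ^ 2
    + (S.tLxy * c.rhoyy / c.muy ^ 2 + c.rhoxy / c.muy) * (1 + S.tLxy / c.muy)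
      * ‖gradY f xstar (lowerSol g xstar)‖
    + 3 * (S.tLxy * c.rhoyy / c.muy ^ 2 + c.rhoxy / c.muy) * (1 + S.tLxy / c.muy)
      * (S.Lxy + S.Ly * S.tLxy / c.muy)
      * Real.sqrt (2 / c.mux * (Phi f g 0 - Phi f g xstar) + ‖xstar‖ ^ 2 + ε / c.mux)

/-- The order of `L_Φ`:
`1/μ_y² + (ρ_yy/μ_y³ + ρ_xy/μ_y²) (Δ* + √ε / (√μ_x μ_y))`. -/
def LPhiOrder {p q : ℕ} (c : CondParams) (f g : Vec p → Vec q → ℝ) (xstar : Vec p) (ε : ℝ) : ℝ :=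
  1 / c.muy ^ 2 + (c.rhoyy / c.muy ^ 3 + c.rhoxy / c.muy ^ 2)
    * (DeltaStar c f g xstar + Real.sqrt ε / (Real.sqrt c.mux * c.muy))

/-- The condition number `κ_x = L_Φ / μ_x`. -/
def kappax {p q : ℕ} (S : SmoothConsts) (c : CondParams) (f g : Vec p → Vec q → ℝ)
    (xstar : Vec p) (ε : ℝ) : ℝ :=
  LPhi S c f g xstar ε / c.mux

/-- The order of the complexity, without the logarithms:
`√(L̃_y/(μ_x μ_y³)) + (√(ρ_yy L̃_y/(μ_x μ_y⁴)) + √(ρ_xy L̃_y/(μ_x μ_y³))) √Δ*`. -/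
def complexityOrder {p q : ℕ} (c : CondParams) (f g : Vec p → Vec q → ℝ) (xstar : Vec p) : ℝ :=
  Real.sqrt (c.tLy / (c.mux * c.muy ^ 3))
    + (Real.sqrt (c.rhoyy * c.tLy / (c.mux * c.muy ^ 4))
        + Real.sqrt (c.rhoxy * c.tLy / (c.mux * c.muy ^ 3)))
      * Real.sqrt (DeltaStar c f g xstar)

/-- The logarithmic factor: the logarithm of a sum of the parameters of the problem. The logarithm
of any polynomial in these parameters is at most a constant times it. -/
def logFactor {p q : ℕ} (c : CondParams) (f g : Vec p → Vec q → ℝ) (xstar : Vec p) (ε : ℝ) : ℝ :=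
  Real.log (2 + 1 / c.mux + 1 / c.muy + c.tLy + c.rhoxy + c.rhoyy + ‖xstar‖
    + ‖lowerSol g xstar‖ + ‖gradY f xstar (lowerSol g xstar)‖
    + (Phi f g 0 - Phi f g xstar) + ε + 1 / ε)

end Bilevel

end

/-! The lower-level solution is Lipschitz in `x` and its derivative follows from differentiating
`∇_y g(x, y*(x)) = 0`. Hence `Φ` has gradient `hyperGradient`, which involves the inverse Hessian
applied to `∇_y f`. When two hypergradients are compared, the difference can be split so that `‖∇_y
f‖` enters at one of the two points only (`norm_hyperGradient_sub_le`). This quantity grows at most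
linearly with the distance to `x*`, so `L_Φ` is a valid Lipschitz constant based at any point within
three radii of `x*` (`norm_hyperGradient_sub_le_LPhi`). This replaces a global bound on `∇_y f`.

The outer loop is Nesterov's method with an inexact gradient. `nesterov_step` contracts a Lyapunov
function by `1 - 1/√κ_x`, up to the gradient error. `inexact_nesterov_rate` is a bootstrap: the
Lyapunov bound confines the iterates to the region where the Lipschitz and error bounds hold, and
these give the next Lyapunov bound. The radius in `L_Φ` is the one for which this closes.

The gradient error comes from the two inner loops. Accelerated descent is the exact case of the same
Nesterov lemma. The heavy ball is a two-term linear recursion with a symmetric operator, controlled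
by an explicit quadratic form (`norm_le_of_two_term_recursion`). All parameters are bounded by one
number `Y`, so every quantity involved is at most a fixed power of `Y`, while `c₀ √κ_y Λ` inner
steps give an error factor below `Y⁻⁴⁰`.

For the complexity, the cost is of order `√κ_x √κ_y Λ²`. If `ε` exceeds the initial gap, no
iteration is needed. Otherwise the `√ε` term in the order of `L_Φ` is dominated by `Δ*`, which
leaves the stated bound. -/

open scoped InnerProductSpace

namespace Bilevel

/-! ### Strong convexity, the descent lemma and one inexact Nesterov step. -/

section ConvexAnalysis

variable {E : Type*} [NormedAddCommGroup E] [InnerProductSpace ℝ E]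

/-- The growth of a strongly convex function away from its minimizer; no differentiability is
needed. -/
theorem StrongConvexOn.add_sq_norm_le {f : E → ℝ} {m : ℝ} (hf : StrongConvexOn univ m f)
    {x : E} (hx : IsMinOn f univ x) (y : E) :
    f x + m / 2 * ‖y - x‖ ^ 2 ≤ f y := by
  -- Convexity on the segment, divided by `t`, gives the claim with an extra factor `1 - t` on the
  -- quadratic term; `t → 0+` removes it.
  have hlim : Filter.Tendsto (fun t : ℝ => f y - f x - (1 - t) * (m / 2 * ‖y - x‖ ^ 2))
      (nhdsWithin 0 (Ioi 0)) (nhds (f y - f x - (1 - 0) * (m / 2 * ‖y - x‖ ^ 2))) := by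
    apply tendsto_nhdsWithin_of_tendsto_nhds
    apply Continuous.tendsto
    fun_prop
  have := ge_of_tendsto (b := 0) hlim ?_
  · linarith
  · filter_upwards [Ioo_mem_nhdsGT (show (0 : ℝ) < 1 by norm_num)] with t ht
    have hc := hf.2 (mem_univ x) (mem_univ y) (sub_nonneg.2 ht.2.le) ht.1.le (by ring)
    simp only [smul_eq_mul] at hc
    rw [norm_sub_rev x y] at hc
    have hm : f x ≤ f ((1 - t) • x + t • y) := hx (mem_univ _)
    have : 0 ≤ t * (f y - f x - (1 - t) * (m / 2 * ‖y - x‖ ^ 2)) := by nlinarith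
    exact nonneg_of_mul_nonneg_right this ht.1

variable [CompleteSpace E]

theorem hasDerivAt_comp_line {f : E → ℝ} {x d f' : E} {t : ℝ}
    (hf : HasGradientAt f f' (x + t • d)) :
    HasDerivAt (fun s : ℝ => f (x + s • d)) ⟪f', d⟫_ℝ t := by
  have h1 : HasDerivAt (fun s : ℝ => x + s • d) d t := by
    simpa using ((hasDerivAt_id t).smul_const d).const_add x
  have h2 := hf.hasFDerivAt.comp_hasDerivAt t h1
  simpa [Function.comp_def] using h2

/-- The first-order lower bound for strongly convex functions. -/
theorem StrongConvexOn.add_inner_le {f : E → ℝ} {m : ℝ} (hf : StrongConvexOn univ m f)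
    {x f' : E} (hx : HasGradientAt f f' x) (y : E) :
    f x + ⟪f', y - x⟫_ℝ + m / 2 * ‖y - x‖ ^ 2 ≤ f y := by
  set d := y - x with hd
  have h0 : HasDerivAt (fun s : ℝ => f (x + s • d)) ⟪f', d⟫_ℝ 0 :=
    hasDerivAt_comp_line (by simpa using hx)
  have hslope := h0.tendsto_slope_zero_right
  have hlim : Filter.Tendsto (fun t : ℝ => f y - f x - (1 - t) * (m / 2 * ‖d‖ ^ 2))
      (nhdsWithin 0 (Ioi 0)) (nhds (f y - f x - (1 - 0) * (m / 2 * ‖d‖ ^ 2))) := by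
    apply tendsto_nhdsWithin_of_tendsto_nhds
    apply Continuous.tendsto
    fun_prop
  have hle := le_of_tendsto_of_tendsto hslope hlim ?_
  · linarith
  · filter_upwards [Ioo_mem_nhdsGT (show (0 : ℝ) < 1 by norm_num)] with t ht
    have hc := hf.2 (mem_univ x) (mem_univ y) (sub_nonneg.2 ht.2.le) ht.1.le (by ring)
    have hpt : (1 - t) • x + t • y = x + t • d := by
      rw [hd, smul_sub, sub_smul, one_smul]; abel
    rw [hpt] at hc
    simp only [smul_eq_mul] at hc
    rw [norm_sub_rev x y, ← hd] at hc
    simp only [zero_add, zero_smul, add_zero, smul_eq_mul]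
    rw [inv_mul_le_iff₀ ht.1]
    nlinarith [hc]

theorem StrongConvexOn.le_inner_sub {f : E → ℝ} {m : ℝ} (hf : StrongConvexOn univ m f)
    {x y f'x f'y : E} (hx : HasGradientAt f f'x x) (hy : HasGradientAt f f'y y) :
    m * ‖x - y‖ ^ 2 ≤ ⟪f'x - f'y, x - y⟫_ℝ := by
  have h1 := StrongConvexOn.add_inner_le hf hx y
  have h2 := StrongConvexOn.add_inner_le hf hy x
  rw [norm_sub_rev y x] at h1
  have : ⟪f'x, y - x⟫_ℝ = - ⟪f'x, x - y⟫_ℝ := by rw [← inner_neg_right, neg_sub]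
  rw [inner_sub_left]
  linarith

theorem StrongConvexOn.mul_norm_sub_le {f : E → ℝ} {m : ℝ} (hf : StrongConvexOn univ m f)
    {x y f'x f'y : E} (hx : HasGradientAt f f'x x) (hy : HasGradientAt f f'y y) :
    m * ‖x - y‖ ≤ ‖f'x - f'y‖ := by
  rcases (norm_nonneg (x - y)).eq_or_lt with h | h
  · rw [← h]; simp
  · have h1 := StrongConvexOn.le_inner_sub hf hx hy
    have h2 := real_inner_le_norm (f'x - f'y) (x - y)
    have : m * ‖x - y‖ * ‖x - y‖ ≤ ‖f'x - f'y‖ * ‖x - y‖ := by nlinarith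
    exact le_of_mul_le_mul_right this h

theorem IsMinOn.hasGradientAt_eq_zero {f : E → ℝ} {x f' : E} (h : IsMinOn f univ x)
    (hx : HasGradientAt f f' x) : f' = 0 := by
  have h1 : IsLocalMin f x := h.isLocalMin Filter.univ_mem
  have h2 := h1.hasFDerivAt_eq_zero hx.hasFDerivAt
  simpa using h2

theorem StrongConvexOn.exists_isMinOn [FiniteDimensional ℝ E] {f : E → ℝ} {m : ℝ} (hm : 0 < m)
    (hf : StrongConvexOn univ m f) (hd : Differentiable ℝ f) : ∃ x, IsMinOn f univ x := by
  have h0 := (hd 0).hasGradientAt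
  set v := gradient f 0
  -- Beyond the radius `2 ‖v‖ / m` the quadratic term of the lower bound at `0` outweighs the linear
  -- one, so only a compact ball matters.
  have hlb : ∀ y, 2 * ‖v‖ / m < ‖y‖ → f 0 ≤ f y := by
    intro y hy
    have h1 := StrongConvexOn.add_inner_le hf h0 y
    rw [sub_zero] at h1
    have h2 := abs_le.1 (abs_real_inner_le_norm v y)
    rw [div_lt_iff₀ hm] at hy
    nlinarith [norm_nonneg y, mul_nonneg (norm_nonneg y) (norm_nonneg y), h2.1]
  obtain ⟨x, hx⟩ := hd.continuous.exists_forall_le' (x₀ := 0) (by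
    have := Metric.isBounded_closedBall (x := (0 : E)) (r := 2 * ‖v‖ / m)
    rw [Filter.eventually_iff, Metric.cobounded_eq_cocompact.symm]
    refine Filter.mem_of_superset (Bornology.isBounded_def.1 this) ?_
    intro y hy
    exact hlb y (by simpa using hy))
  exact ⟨x, fun y _ => hx y⟩

/-- The descent lemma at a point `x`, under a Lipschitz bound of the gradient with base `x`. -/
theorem le_add_inner_add_sq_norm {f : E → ℝ} {f' : E → E} {L : ℝ} {x : E}
    (hf : ∀ z, HasGradientAt f (f' z) z) (hL : ∀ z, ‖f' z - f' x‖ ≤ L * ‖z - x‖) (y : E) :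
    f y ≤ f x + ⟪f' x, y - x⟫_ℝ + L / 2 * ‖y - x‖ ^ 2 := by
  set d := y - x with hd
  -- The derivative of `φ` compares gradients at `x + t d` and at `x` only, so a Lipschitz bound
  -- based at `x` suffices.
  let φ : ℝ → ℝ := fun t => f (x + t • d) - t * ⟪f' x, d⟫_ℝ - L / 2 * ‖d‖ ^ 2 * t ^ 2
  have hφ : ∀ t, HasDerivAt φ (⟪f' (x + t • d), d⟫_ℝ - ⟪f' x, d⟫_ℝ - L * ‖d‖ ^ 2 * t) t := by
    intro t
    have h1 := hasDerivAt_comp_line (hf (x + t • d))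
    have h2 := (hasDerivAt_id t).mul_const ⟪f' x, d⟫_ℝ
    have h3 := (hasDerivAt_pow 2 t).const_mul (L / 2 * ‖d‖ ^ 2)
    refine HasDerivAt.congr_deriv (f := φ) ((h1.sub h2).sub h3) ?_
    push_cast; ring
  have hanti : AntitoneOn φ (Icc 0 1) := by
    apply antitoneOn_of_deriv_nonpos (convex_Icc 0 1)
    · exact fun t _ => (hφ t).continuousAt.continuousWithinAt
    · exact fun t _ => (hφ t).differentiableAt.differentiableWithinAt
    · intro t ht
      rw [interior_Icc] at ht
      rw [(hφ t).deriv, ← inner_sub_left]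
      have h1 := real_inner_le_norm (f' (x + t • d) - f' x) d
      have h2 := hL (x + t • d)
      rw [add_sub_cancel_left, norm_smul, Real.norm_of_nonneg ht.1.le] at h2
      nlinarith [mul_le_mul_of_nonneg_right h2 (norm_nonneg d)]
  have := hanti (left_mem_Icc.2 zero_le_one) (right_mem_Icc.2 zero_le_one) zero_le_one
  simp only [φ, one_smul, zero_smul, add_zero, hd, add_sub_cancel] at this
  rw [← hd] at this
  linarith

/-- One step of Nesterov's method with an inexact gradient `G`, in the form in which
`x = (z + α w) / (1 + α)`: the Lyapunov function `f z - f x* + (m / 2) ‖w - x*‖²` contracts by the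
factor `1 - α`, up to an error proportional to `‖G - ∇f x‖`. -/
theorem nesterov_step {f : E → ℝ} {f' : E → E} {m L α : ℝ} (hm : 0 < m) (hL : 0 < L)
    (hα0 : 0 < α) (hα1 : α ≤ 1) (hα : α ^ 2 * L = m)
    (hsc : StrongConvexOn univ m f) (hf : ∀ z, HasGradientAt f (f' z) z)
    {x z w G xs : E} (hLip : ∀ u, ‖f' u - f' x‖ ≤ L * ‖u - x‖)
    (hx : α • w = (1 + α) • x - z) :
    f (x - (1 / L) • G) - f xs
        + m / 2 * ‖(z + (1 / α) • (x - (1 / L) • G - z)) - xs‖ ^ 2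
      ≤ (1 - α) * (f z - f xs + m / 2 * ‖w - xs‖ ^ 2)
        + ‖G - f' x‖ * ((1 - α) * ‖z - xs‖ + ‖x - (1 / L) • G - xs‖) := by
  have hd := le_add_inner_add_sq_norm hf hLip (x - (1 / L) • G)
  have hz := StrongConvexOn.add_inner_le hsc (hf x) z
  have hs := StrongConvexOn.add_inner_le hsc (hf x) xs
  set g := f' x
  -- coordinates centred at the minimizer
  obtain ⟨X, rfl⟩ : ∃ X, x = xs + X := ⟨x - xs, by abel⟩
  obtain ⟨Z, rfl⟩ : ∃ Z, z = xs + Z := ⟨z - xs, by abel⟩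
  obtain ⟨W, rfl⟩ : ∃ W, w = xs + W := ⟨w - xs, by abel⟩
  obtain ⟨e, rfl⟩ : ∃ e, G = g + e := ⟨G - g, by abel⟩
  have hX : Z = (1 + α) • X - α • W := by
    rw [smul_add, smul_add, add_smul 1 α xs, one_smul] at hx
    have : α • W = (1 + α) • X - Z := by
      have := congrArg (fun u => u - α • xs) hx
      simp only [add_sub_cancel_left] at this
      rw [this]; abel
    rw [this]; abel
  -- The new auxiliary point is a step along `-G` from the convex combination `(1 - α) w + α x`.
  have hw : xs + Z + (1 / α) • (xs + X - (1 / L) • (g + e) - (xs + Z)) - xs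
      = (1 - α) • W + α • X - (1 / (α * L)) • (g + e) := by
    rw [hX]
    match_scalars <;> field_simp <;> ring
  rw [hw]
  have e1 : xs + X - (1 / L) • (g + e) - (xs + X) = - ((1 / L) • (g + e)) := by abel
  have e2 : xs + Z - (xs + X) = Z - X := by abel
  have e3 : xs - (xs + X) = -X := by abel
  have e4 : xs + X - (1 / L) • (g + e) - xs = X - (1 / L) • (g + e) := by abel
  rw [e1, inner_neg_right, norm_neg, norm_smul, inner_smul_right,
    Real.norm_of_nonneg (by positivity)] at hd
  rw [e2] at hz
  rw [e3, norm_neg, inner_neg_right] at hs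
  rw [e4, add_sub_cancel_left, add_sub_cancel_left, add_sub_cancel_left]
  -- the error term
  have herr : ⟪e, (1 - α) • Z - (X - (1 / L) • (g + e))⟫_ℝ
      ≤ ‖e‖ * ((1 - α) * ‖Z‖ + ‖X - (1 / L) • (g + e)‖) := by
    refine (real_inner_le_norm _ _).trans (mul_le_mul_of_nonneg_left ?_ (norm_nonneg _))
    refine (norm_sub_le _ _).trans ?_
    rw [norm_smul, Real.norm_of_nonneg (by linarith)]
  refine le_trans ?_ (add_le_add_right herr _)
  have hcvx : ‖(1 - α) • W + α • X‖ ^ 2 ≤ (1 - α) * ‖W‖ ^ 2 + α * ‖X‖ ^ 2 := by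
    have h1 : ‖(1 - α) • W + α • X‖ ^ 2
        = (1 - α) * ‖W‖ ^ 2 + α * ‖X‖ ^ 2 - α * (1 - α) * ‖W - X‖ ^ 2 := by
      rw [norm_add_sq_real, norm_sub_sq_real, norm_smul, norm_smul, inner_smul_left,
        inner_smul_right, mul_pow, mul_pow, Real.norm_eq_abs, Real.norm_eq_abs, sq_abs, sq_abs]
      simp only [conj_trivial]; ring
    rw [h1]
    nlinarith [mul_nonneg (mul_nonneg hα0.le (sub_nonneg.2 hα1)) (sq_nonneg ‖W - X‖)]
  have hsq : ‖(1 - α) • W + α • X - (1 / (α * L)) • (g + e)‖ ^ 2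
      = ‖(1 - α) • W + α • X‖ ^ 2 - 2 / (α * L) * ⟪g + e, (1 - α) • W + α • X⟫_ℝ
        + 1 / (α * L) ^ 2 * ‖g + e‖ ^ 2 := by
    rw [norm_sub_sq_real, inner_smul_right, norm_smul, Real.norm_of_nonneg (by positivity),
      real_inner_comm]
    ring
  -- The coupling of `x`, `z` and `w` turns the cross term into the combination of inner products
  -- found in the first-order bounds towards `z` and `xs`.
  have hin : α * ⟪g + e, (1 - α) • W + α • X⟫_ℝ
      = ⟪g + e, (1 - α) • (X - Z) + α • X⟫_ℝ := by
    rw [← inner_smul_right]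
    congr 1
    rw [hX]
    module
  have hmα : m / 2 * (2 / (α * L)) = α := by rw [← hα]; field_simp
  -- Because `α² L = m`, the squared step of the auxiliary point costs exactly the `‖G‖² / (2 L)`
  -- gained in the descent lemma.
  have hmα2 : m / 2 * (1 / (α * L) ^ 2) = 1 / (2 * L) := by rw [← hα]; field_simp
  have key : m / 2 * ‖(1 - α) • W + α • X - (1 / (α * L)) • (g + e)‖ ^ 2
      = m / 2 * ‖(1 - α) • W + α • X‖ ^ 2 - ⟪g + e, (1 - α) • (X - Z) + α • X⟫_ℝ
        + 1 / (2 * L) * ‖g + e‖ ^ 2 := by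
    rw [hsq, ← hin, ← hmα2]
    linear_combination (-⟪g + e, (1 - α) • W + α • X⟫_ℝ) * hmα
  rw [key]
  have hge : ⟪g, g + e⟫_ℝ = ‖g + e‖ ^ 2 - ⟪e, g + e⟫_ℝ := by
    rw [← real_inner_self_eq_norm_sq, inner_add_left g e (g + e)]; ring
  rw [hge] at hd
  have i1 : ⟪g + e, (1 - α) • (X - Z) + α • X⟫_ℝ
      = - (1 - α) * ⟪g, Z - X⟫_ℝ + α * ⟪g, X⟫_ℝ + (⟪e, X⟫_ℝ - (1 - α) * ⟪e, Z⟫_ℝ) := by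
    simp only [inner_add_left, inner_add_right, inner_smul_right, inner_sub_right]; ring
  have i2 : ⟪e, (1 - α) • Z - (X - (1 / L) • (g + e))⟫_ℝ
      = (1 - α) * ⟪e, Z⟫_ℝ - ⟪e, X⟫_ℝ + 1 / L * ⟪e, g + e⟫_ℝ := by
    simp only [inner_smul_right, inner_sub_right]; ring
  rw [i1, i2]
  -- The first-order bounds towards `z` and `xs` are added with weights `1 - α` and `α`. All exact
  -- inner products cancel, and only those with `e` remain.
  have hcv := mul_le_mul_of_nonneg_left hcvx (by positivity : 0 ≤ m / 2)
  have hz' := mul_le_mul_of_nonneg_left hz (sub_nonneg.2 hα1)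
  have hs' := mul_le_mul_of_nonneg_left hs hα0.le
  have hquad : L / 2 * (1 / L * ‖g + e‖) ^ 2 = 1 / (2 * L) * ‖g + e‖ ^ 2 := by field_simp
  have hl : 1 / L * ‖g + e‖ ^ 2 = 2 * (1 / (2 * L) * ‖g + e‖ ^ 2) := by field_simp
  rw [hquad] at hd
  have hzz : 0 ≤ (1 - α) * (m / 2 * ‖Z - X‖ ^ 2) :=
    mul_nonneg (sub_nonneg.2 hα1) (by positivity)
  linarith

end ConvexAnalysis

/-! ### Nesterov's method with inexact and with exact gradients. -/

section Nesterov

variable {E : Type*} [NormedAddCommGroup E] [InnerProductSpace ℝ E]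

/-- The momentum step of Nesterov's method, in terms of the auxiliary sequence of
`nesterov_step`. -/
theorem smul_momentum_eq {α : ℝ} (hα : 0 < α) {z z' x' : E}
    (hx : x' = (1 + (1 - α) / (1 + α)) • z' - ((1 - α) / (1 + α)) • z) :
    α • (z + (1 / α) • (z' - z)) = (1 + α) • x' - z' := by
  have : (1 + α) ≠ 0 := by positivity
  rw [hx]
  match_scalars <;> field_simp <;> ring

variable [CompleteSpace E]

/-- Nesterov's method with inexact gradients `G n`. The Lipschitz bound of the gradient and the
bound for the error of `G n` are only needed at points at distance at most `3 R` from the minimizer,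
where the iterates are shown to stay. -/
theorem inexact_nesterov_rate {f : E → ℝ} {f' : E → E} {m L α R δ η : ℝ} (hm : 0 < m) (hL : 0 < L)
    (hα0 : 0 < α) (hα1 : α ≤ 1) (hα : α ^ 2 * L = m)
    (hsc : StrongConvexOn univ m f) (hf : ∀ z, HasGradientAt f (f' z) z)
    {xs : E} (hmin : IsMinOn f univ xs) {x z G : ℕ → E} (hx0 : x 0 = 0) (hz0 : z 0 = 0)
    (hz : ∀ n, z (n + 1) = x n - (1 / L) • G n)
    (hx : ∀ n, x (n + 1)
      = (1 + (1 - α) / (1 + α)) • z (n + 1) - ((1 - α) / (1 + α)) • z n)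
    (hδ0 : 0 ≤ δ) (hη0 : 0 ≤ η) (hR0 : 0 ≤ R)
    (hLip : ∀ n, ‖x n - xs‖ ≤ 3 * R → ∀ u, ‖f' u - f' (x n)‖ ≤ L * ‖u - x n‖)
    (hG : ∀ n, ‖x n - xs‖ ≤ 3 * R → ‖G n - f' (x n)‖ ≤ δ)
    (hR : 2 / m * (f 0 - f xs + m / 2 * ‖xs‖ ^ 2 + η) ≤ R ^ 2)
    (hδ : δ * (7 * R + δ / L) ≤ α * η) (n : ℕ) :
    f (z n) - f xs ≤ (1 - α) ^ n * (f 0 - f xs + m / 2 * ‖xs‖ ^ 2) + η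
      ∧ ‖x n - xs‖ ≤ 3 * R := by
  set V₀ := f 0 - f xs + m / 2 * ‖xs‖ ^ 2 with hV₀
  have hm0 : ∀ y, f xs ≤ f y := fun y => hmin (mem_univ y)
  have hV₀0 : 0 ≤ V₀ := add_nonneg (sub_nonneg.2 (hm0 0)) (by positivity)
  -- Quadratic growth converts a bound on the function gap into distance `R`; this starts the
  -- bootstrap at every step.
  have hgrow : ∀ y, f y - f xs ≤ V₀ + η → ‖y - xs‖ ≤ R := by
    intro y hy
    have h1 := StrongConvexOn.add_sq_norm_le hsc hmin y
    have h2 : ‖y - xs‖ ^ 2 ≤ 2 / m * (V₀ + η) := by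
      rw [div_mul_eq_mul_div, le_div_iff₀ hm]; linarith
    exact abs_le_of_sq_le_sq' (h2.trans hR) hR0 |>.2
  have hpow : ∀ n, (1 - α) ^ n * V₀ ≤ V₀ := fun n =>
    mul_le_of_le_one_left hV₀0 (pow_le_one₀ (sub_nonneg.2 hα1) (by linarith))
  have hf's : f' xs = 0 := IsMinOn.hasGradientAt_eq_zero hmin (hf xs)
  -- The auxiliary point is recovered from `x n` and `z n`. The additive error stays equal to `η`
  -- because `(1 - α) η + α η = η`.
  have main : ∀ n, f (z n) - f xs + m / 2 * ‖(1 / α) • ((1 + α) • x n - z n) - xs‖ ^ 2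
      ≤ (1 - α) ^ n * V₀ + η ∧ ‖x n - xs‖ ≤ 3 * R := by
    intro n
    induction n with
    | zero =>
      simp only [hx0, hz0, smul_zero, sub_zero, zero_sub, norm_neg, pow_zero, one_mul]
      refine ⟨by linarith, ?_⟩
      have := hgrow 0 (by rw [hV₀]; nlinarith [sq_nonneg ‖xs‖])
      rw [zero_sub, norm_neg] at this
      linarith
    | succ n ih =>
      obtain ⟨hV, hxn⟩ := ih
      have hzn : ‖z n - xs‖ ≤ R := by
        apply hgrow
        have : 0 ≤ m / 2 * ‖(1 / α) • ((1 + α) • x n - z n) - xs‖ ^ 2 := by positivity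
        linarith [hpow n]
      have he := hG n hxn
      have hlip := hLip n hxn
      have hfx : ‖f' (x n)‖ ≤ L * (3 * R) := by
        have := hlip xs
        rw [hf's, zero_sub, norm_neg, norm_sub_rev] at this
        exact this.trans (mul_le_mul_of_nonneg_left hxn hL.le)
      have hGn : ‖G n‖ ≤ L * (3 * R) + δ := by
        have : G n = f' (x n) + (G n - f' (x n)) := by abel
        rw [this]
        exact (norm_add_le _ _).trans (add_le_add hfx he)
      -- An a priori bound: `3 R` from `x n`, and `3 R + δ / L` from the step. With `‖z n - xs‖ ≤ R`
      -- it yields the `7 R` of `hδ`.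
      have hz1 : ‖z (n + 1) - xs‖ ≤ 6 * R + δ / L := by
        have : z (n + 1) - xs = (x n - xs) - (1 / L) • G n := by rw [hz n]; abel
        rw [this]
        refine (norm_sub_le _ _).trans ?_
        rw [norm_smul, Real.norm_of_nonneg (by positivity)]
        have h1 : 1 / L * ‖G n‖ ≤ 1 / L * (L * (3 * R) + δ) :=
          mul_le_mul_of_nonneg_left hGn (by positivity)
        have h2 : 1 / L * (L * (3 * R) + δ) = 3 * R + δ / L := by field_simp
        linarith
      have hw : α • ((1 / α) • ((1 + α) • x n - z n)) = (1 + α) • x n - z n := by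
        rw [smul_smul, mul_one_div_cancel hα0.ne', one_smul]
      have hstep := nesterov_step (xs := xs) (G := G n) hm hL hα0 hα1 hα hsc hf hlip hw
      rw [← hz n] at hstep
      have hw' := smul_momentum_eq hα0 (hx n)
      have hw'' : (1 / α) • ((1 + α) • x (n + 1) - z (n + 1))
          = z n + (1 / α) • (z (n + 1) - z n) := by
        rw [← hw', smul_smul, one_div_mul_cancel hα0.ne', one_smul]
      have hV1 : f (z (n + 1)) - f xs
          + m / 2 * ‖(1 / α) • ((1 + α) • x (n + 1) - z (n + 1)) - xs‖ ^ 2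
          ≤ (1 - α) ^ (n + 1) * V₀ + η := by
        rw [hw'']
        refine hstep.trans ?_
        have h1 : ‖G n - f' (x n)‖ * ((1 - α) * ‖z n - xs‖ + ‖z (n + 1) - xs‖)
            ≤ δ * (7 * R + δ / L) := by
          refine mul_le_mul he ?_ ?_ hδ0
          · have : (1 - α) * ‖z n - xs‖ ≤ 1 * R :=
              mul_le_mul (by linarith) hzn (norm_nonneg _) zero_le_one
            linarith
          · exact add_nonneg (mul_nonneg (sub_nonneg.2 hα1) (norm_nonneg _)) (norm_nonneg _)
        have h2 := mul_le_mul_of_nonneg_left hV (sub_nonneg.2 hα1)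
        rw [pow_succ (1 - α) n]
        linarith
      refine ⟨hV1, ?_⟩
      have hzn1 : ‖z (n + 1) - xs‖ ≤ R := by
        apply hgrow
        have : 0 ≤ m / 2 * ‖(1 / α) • ((1 + α) • x (n + 1) - z (n + 1)) - xs‖ ^ 2 := by positivity
        linarith [hpow (n + 1)]
      have hm0' : 0 ≤ (1 - α) / (1 + α) := div_nonneg (by linarith) (by linarith)
      have hm1 : (1 - α) / (1 + α) ≤ 1 := by rw [div_le_one (by linarith)]; linarith
      -- With momentum coefficient at most `1`, two points within `R` give an extrapolated point
      -- within `2 R + R`.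
      have : x (n + 1) - xs = (1 + (1 - α) / (1 + α)) • (z (n + 1) - xs)
          - ((1 - α) / (1 + α)) • (z n - xs) := by rw [hx n]; module
      rw [this]
      refine (norm_sub_le _ _).trans ?_
      rw [norm_smul, norm_smul, Real.norm_of_nonneg (by linarith), Real.norm_of_nonneg hm0']
      nlinarith [norm_nonneg (z n - xs), norm_nonneg (z (n + 1) - xs)]
  obtain ⟨h1, h2⟩ := main n
  have : 0 ≤ m / 2 * ‖(1 / α) • ((1 + α) • x n - z n) - xs‖ ^ 2 := by positivity
  exact ⟨by linarith, h2⟩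

/-- The linear rate of Nesterov's method with exact gradients, for the distance to the minimizer. -/
theorem nesterov_sq_norm_sub_le {f : E → ℝ} {f' : E → E} {m L α : ℝ} (hm : 0 < m) (hL : 0 < L)
    (hα0 : 0 < α) (hα1 : α ≤ 1) (hα : α ^ 2 * L = m)
    (hsc : StrongConvexOn univ m f) (hf : ∀ z, HasGradientAt f (f' z) z)
    (hLip : ∀ u v, ‖f' u - f' v‖ ≤ L * ‖u - v‖)
    {xs : E} (hmin : IsMinOn f univ xs) {x z : ℕ → E} (hx0 : x 0 = 0) (hz0 : z 0 = 0)
    (hz : ∀ n, z (n + 1) = x n - (1 / L) • f' (x n))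
    (hx : ∀ n, x (n + 1)
      = (1 + (1 - α) / (1 + α)) • z (n + 1) - ((1 - α) / (1 + α)) • z n) (n : ℕ) :
    ‖z n - xs‖ ^ 2 ≤ (1 - α) ^ n * ((L / m + 1) * ‖xs‖ ^ 2) := by
  have hf's : f' xs = 0 := IsMinOn.hasGradientAt_eq_zero hmin (hf xs)
  have hV : 0 ≤ 2 / m * (f 0 - f xs + m / 2 * ‖xs‖ ^ 2 + 0) := by
    have : f xs ≤ f 0 := hmin (mem_univ _)
    have : 0 ≤ f 0 - f xs := by linarith
    positivity
  have h := (inexact_nesterov_rate (R := √(2 / m * (f 0 - f xs + m / 2 * ‖xs‖ ^ 2 + 0)))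
    (δ := 0) (η := 0) (G := fun n => f' (x n)) hm hL hα0 hα1 hα hsc hf hmin hx0 hz0 hz hx le_rfl
    le_rfl (Real.sqrt_nonneg _) (fun n _ u => hLip u _) (fun n _ => by simp)
    (Real.sq_sqrt hV).ge (by simp) n).1
  have h1 := StrongConvexOn.add_sq_norm_le hsc hmin (z n)
  -- As the gradient vanishes at `xs`, the initial gap is at most `L / 2 * ‖xs‖²`.
  have h2 := le_add_inner_add_sq_norm hf (fun u => hLip u xs) 0
  rw [hf's, inner_zero_left, zero_sub, norm_neg] at h2
  have hp : 0 ≤ (1 - α) ^ n := pow_nonneg (by linarith) _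
  have h3 : m / 2 * ‖z n - xs‖ ^ 2
      ≤ (1 - α) ^ n * (L / 2 * ‖xs‖ ^ 2 + m / 2 * ‖xs‖ ^ 2) := by
    have : (1 - α) ^ n * (f 0 - f xs + m / 2 * ‖xs‖ ^ 2)
      ≤ (1 - α) ^ n * (L / 2 * ‖xs‖ ^ 2 + m / 2 * ‖xs‖ ^ 2) :=
      mul_le_mul_of_nonneg_left (by linarith) hp
    linarith
  have h4 : (1 - α) ^ n * (L / 2 * ‖xs‖ ^ 2 + m / 2 * ‖xs‖ ^ 2)
      = m / 2 * ((1 - α) ^ n * ((L / m + 1) * ‖xs‖ ^ 2)) := by field_simp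
  rw [h4] at h3
  exact le_of_mul_le_mul_left h3 (by positivity)

end Nesterov

/-! ### A two-term recursion with a symmetric operator. -/

section HeavyBall

variable {E : Type*} [NormedAddCommGroup E] [InnerProductSpace ℝ E]

/-- Polarization with the parallelogram law gives a bound in `‖v‖² + ‖w‖²`. Rescaling both vectors
to the common norm `‖v‖ ‖w‖` turns it into the product form, without spectral theory. -/
theorem abs_inner_le_of_symmetric {S : E →L[ℝ] E} {b : ℝ}
    (hsymm : ∀ v w, ⟪S v, w⟫_ℝ = ⟪v, S w⟫_ℝ) (hS : ∀ v, |⟪S v, v⟫_ℝ| ≤ b * ‖v‖ ^ 2) (v w : E) :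
    |⟪S v, w⟫_ℝ| ≤ b * (‖v‖ * ‖w‖) := by
  have hpol : ∀ v w, 4 * |⟪S v, w⟫_ℝ| ≤ 2 * b * (‖v‖ ^ 2 + ‖w‖ ^ 2) := by
    intro v w
    have h1 := hS (v + w)
    have h2 := hS (v - w)
    have h3 : 4 * ⟪S v, w⟫_ℝ = ⟪S (v + w), v + w⟫_ℝ - ⟪S (v - w), v - w⟫_ℝ := by
      have := hsymm w v
      rw [real_inner_comm (S v) w] at this
      simp only [map_add, map_sub, inner_add_left, inner_add_right, inner_sub_left,
        inner_sub_right]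
      rw [this]; ring
    have h4 := abs_sub (⟪S (v + w), v + w⟫_ℝ) (⟪S (v - w), v - w⟫_ℝ)
    rw [← h3, abs_mul, abs_of_pos (by norm_num : (0 : ℝ) < 4)] at h4
    have h5 := congrArg (b * ·) (parallelogram_law_with_norm ℝ v w)
    linarith
  rcases (norm_nonneg v).eq_or_lt with hv | hv
  · rw [norm_eq_zero.1 hv.symm]; simp
  rcases (norm_nonneg w).eq_or_lt with hw | hw
  · rw [norm_eq_zero.1 hw.symm]; simp
  have h := hpol (‖w‖ • v) (‖v‖ • w)
  rw [map_smul, inner_smul_left, inner_smul_right, norm_smul, norm_smul, norm_norm, norm_norm,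
    abs_mul, abs_mul, conj_trivial, abs_of_pos hv, abs_of_pos hw] at h
  have hvw : 0 < ‖v‖ * ‖w‖ := mul_pos hv hw
  have : (‖v‖ * ‖w‖) * |⟪S v, w⟫_ℝ| ≤ (‖v‖ * ‖w‖) * (b * (‖v‖ * ‖w‖)) := by nlinarith
  exact le_of_mul_le_mul_left this hvw

/-- A two-term recursion with a symmetric operator `S` of norm at most `2 β`: the quadratic form
`‖e_{n+1}‖² - ⟪S e_{n+1}, e_n⟫ + β² ‖e_n‖²` is multiplied by `β²` in each step. -/
theorem norm_le_of_two_term_recursion {S : E →L[ℝ] E} {β : ℝ} (hβ0 : 0 ≤ β) (hβ1 : β ≤ 1)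
    (hsymm : ∀ v w, ⟪S v, w⟫_ℝ = ⟪v, S w⟫_ℝ)
    (hS : ∀ v, |⟪S v, v⟫_ℝ| ≤ 2 * β * ‖v‖ ^ 2) {e : ℕ → E} (h01 : e 1 = e 0)
    (he : ∀ n, e (n + 2) = S (e (n + 1)) - β ^ 2 • e n) (n : ℕ) :
    ‖e (n + 1)‖ ≤ (2 * n + 1) * β ^ n * ‖e 0‖ := by
  let Q : ℕ → ℝ := fun n =>
    ‖e (n + 1)‖ ^ 2 - ⟪S (e (n + 1)), e n⟫_ℝ + β ^ 2 * ‖e n‖ ^ 2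
  have hQ : ∀ n, Q n ≤ (2 * β ^ n * ‖e 0‖) ^ 2 := by
    intro n
    induction n with
    | zero =>
      simp only [Q, zero_add, h01]
      have := abs_le.1 (hS (e 0))
      have h1 : β * ‖e 0‖ ^ 2 ≤ ‖e 0‖ ^ 2 := mul_le_of_le_one_left (sq_nonneg _) hβ1
      have h2 : β ^ 2 * ‖e 0‖ ^ 2 ≤ ‖e 0‖ ^ 2 :=
        mul_le_of_le_one_left (sq_nonneg _) (pow_le_one₀ hβ0 hβ1)
      nlinarith [this.1]
    | succ n ih =>
      have : Q (n + 1) = β ^ 2 * Q n := by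
        -- The identity is exact: symmetry moves `S` onto `e (n + 1)`, and the recursion replaces `e
        -- (n + 2) - S e (n + 1)` by `-β² e n`.
        simp only [Q]
        have h1 : ‖e (n + 1 + 1)‖ ^ 2 - ⟪S (e (n + 1 + 1)), e (n + 1)⟫_ℝ
            = - β ^ 2 * ⟪S (e (n + 1)), e n⟫_ℝ + β ^ 4 * ‖e n‖ ^ 2 := by
          rw [hsymm, ← real_inner_self_eq_norm_sq, ← inner_sub_right]
          have : e (n + 1 + 1) - S (e (n + 1)) = - (β ^ 2 • e n) := by rw [he n]; abel
          rw [this, he n, inner_neg_right, inner_smul_right, inner_sub_left, inner_smul_left,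
            real_inner_self_eq_norm_sq, conj_trivial]
          ring
        rw [h1]; ring
      rw [this]
      have := mul_le_mul_of_nonneg_left ih (sq_nonneg β)
      calc _ ≤ _ := this
        _ = _ := by ring
  have hstep : ∀ n, ‖e (n + 1)‖ ≤ β * ‖e n‖ + 2 * β ^ n * ‖e 0‖ := by
    intro n
    -- The form dominates `(‖e (n + 1)‖ - β ‖e n‖)²`. It may degenerate when the quadratic form of
    -- `S` reaches `±2 β`, the case of a double root, which is why a linear factor in `n` appears.
    have h1 := abs_le.1 (abs_inner_le_of_symmetric hsymm hS (e (n + 1)) (e n))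
    have h2 : (‖e (n + 1)‖ - β * ‖e n‖) ^ 2 ≤ (2 * β ^ n * ‖e 0‖) ^ 2 := by
      refine le_trans ?_ (hQ n)
      simp only [Q]
      nlinarith [h1.2]
    have := (abs_le_of_sq_le_sq' h2 (by positivity)).2
    linarith
  induction n with
  | zero => simp [h01]
  | succ n ih =>
    refine (hstep (n + 1)).trans ?_
    have := mul_le_mul_of_nonneg_left ih hβ0
    push_cast
    calc _ ≤ β * ((2 * n + 1) * β ^ n * ‖e 0‖) + 2 * β ^ (n + 1) * ‖e 0‖ := by linarith
      _ = _ := by ring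

end HeavyBall

/-! ### The lower-level problem, the gradient of `Φ` and its Lipschitz bounds. -/

theorem pairNorm_le_add {p q : ℕ} (x : Vec p) (y : Vec q) : pairNorm x y ≤ ‖x‖ + ‖y‖ := by
  rw [pairNorm, Real.sqrt_le_left (by positivity)]
  nlinarith [norm_nonneg x, norm_nonneg y, mul_nonneg (norm_nonneg x) (norm_nonneg y)]

/-- The solution `v` of `∇_y² g(x, y) v = b`. -/
noncomputable def hessSolve {p q : ℕ} (g : Vec p → Vec q → ℝ) (x : Vec p) (y b : Vec q) : Vec q :=
  (hessY g x y).inverse b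

/-- The hypergradient `∇ₓ f - ∇ₓ∇_y g [∇_y² g]⁻¹ ∇_y f` at `(x, y*(x))`. -/
noncomputable def hyperGradient {p q : ℕ} (f g : Vec p → Vec q → ℝ) (x : Vec p) : Vec p :=
  gradX f x (lowerSol g x)
    - jacXY g x (lowerSol g x) (hessSolve g x (lowerSol g x) (gradY f x (lowerSol g x)))

theorem hasFDerivAt_partial_left {p q : ℕ} {F : Type*} [NormedAddCommGroup F] [NormedSpace ℝ F]
    {h : Vec p × Vec q → F} {x : Vec p} {y : Vec q} {h' : Vec p × Vec q →L[ℝ] F}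
    (hh : HasFDerivAt h h' (x, y)) :
    HasFDerivAt (fun x' => h (x', y)) (h'.comp (ContinuousLinearMap.inl ℝ (Vec p) (Vec q))) x :=
  hh.comp x (hasFDerivAt_prodMk_left x y)

theorem hasFDerivAt_partial_right {p q : ℕ} {F : Type*} [NormedAddCommGroup F] [NormedSpace ℝ F]
    {h : Vec p × Vec q → F} {x : Vec p} {y : Vec q} {h' : Vec p × Vec q →L[ℝ] F}
    (hh : HasFDerivAt h h' (x, y)) :
    HasFDerivAt (fun y' => h (x, y')) (h'.comp (ContinuousLinearMap.inr ℝ (Vec p) (Vec q))) y :=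
  hh.comp y (hasFDerivAt_prodMk_right x y)

theorem hasGradientAt_gradY {p q : ℕ} {h : Vec p → Vec q → ℝ}
    (hh : ContDiff ℝ 1 (fun w : Vec p × Vec q => h w.1 w.2)) (x : Vec p) (y : Vec q) :
    HasGradientAt (h x) (gradY h x y) y :=
  (hasFDerivAt_partial_right ((hh.differentiable one_ne_zero) (x, y)).hasFDerivAt)
    |>.differentiableAt.hasGradientAt

theorem hasGradientAt_gradX {p q : ℕ} {h : Vec p → Vec q → ℝ}
    (hh : ContDiff ℝ 1 (fun w : Vec p × Vec q => h w.1 w.2)) (x : Vec p) (y : Vec q) :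
    HasGradientAt (fun x' => h x' y) (gradX h x y) x :=
  (hasFDerivAt_partial_left ((hh.differentiable one_ne_zero) (x, y)).hasFDerivAt)
    |>.differentiableAt.hasGradientAt

theorem fderiv_prod_apply {p q : ℕ} {h : Vec p → Vec q → ℝ}
    (hh : ContDiff ℝ 1 (fun w : Vec p × Vec q => h w.1 w.2)) (x : Vec p) (y : Vec q)
    (u : Vec p) (v : Vec q) :
    fderiv ℝ (fun w : Vec p × Vec q => h w.1 w.2) (x, y) (u, v)
      = ⟪gradX h x y, u⟫_ℝ + ⟪gradY h x y, v⟫_ℝ := by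
  have hd := ((hh.differentiable one_ne_zero) (x, y)).hasFDerivAt
  have h1 := (hasFDerivAt_partial_left hd).unique (hasGradientAt_gradX hh x y).hasFDerivAt
  have h2 := (hasFDerivAt_partial_right hd).unique (hasGradientAt_gradY hh x y).hasFDerivAt
  have h1' := congrArg (fun T => T u) h1
  have h2' := congrArg (fun T => T v) h2
  simp only [ContinuousLinearMap.comp_apply, ContinuousLinearMap.inl_apply,
    ContinuousLinearMap.inr_apply, InnerProductSpace.toDual_apply_apply] at h1' h2'
  rw [← h1', ← h2', ← map_add]
  simp

namespace IsSCSC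

variable {p q : ℕ} {S : SmoothConsts} {c : CondParams} {f g : Vec p → Vec q → ℝ} {xstar : Vec p}

theorem hasFDerivAt_jac (h : IsSCSC S c f g xstar) (x : Vec p) (y : Vec q) :
    HasFDerivAt (fun x' => gradY g x' y) (fderiv ℝ (fun x' => gradY g x' y) x) x :=
  (hasFDerivAt_partial_left (h.differentiable_gradY_g (x, y)).hasFDerivAt)
    |>.differentiableAt.hasFDerivAt

theorem hasFDerivAt_hess (h : IsSCSC S c f g xstar) (x : Vec p) (y : Vec q) :
    HasFDerivAt (fun y' => gradY g x y') (hessY g x y) y :=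
  (hasFDerivAt_partial_right (h.differentiable_gradY_g (x, y)).hasFDerivAt)
    |>.differentiableAt.hasFDerivAt

theorem fderiv_gradY_apply (h : IsSCSC S c f g xstar) (x : Vec p) (y : Vec q)
    (u : Vec p) (v : Vec q) :
    fderiv ℝ (fun w : Vec p × Vec q => gradY g w.1 w.2) (x, y) (u, v)
      = fderiv ℝ (fun x' => gradY g x' y) x u + hessY g x y v := by
  have hd := (h.differentiable_gradY_g (x, y)).hasFDerivAt
  have h1 := congrArg (fun T => T u) ((hasFDerivAt_partial_left hd).unique (h.hasFDerivAt_jac x y))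
  have h2 := congrArg (fun T => T v)
    ((hasFDerivAt_partial_right hd).unique (h.hasFDerivAt_hess x y))
  simp only [ContinuousLinearMap.comp_apply, ContinuousLinearMap.inl_apply,
    ContinuousLinearMap.inr_apply] at h1 h2
  rw [← h1, ← h2, ← map_add]
  simp

theorem isMinOn_lowerSol (h : IsSCSC S c f g xstar) (x : Vec p) :
    IsMinOn (g x) univ (lowerSol g x) :=
  Classical.epsilon_spec (StrongConvexOn.exists_isMinOn h.muy_pos (h.strongConvex_g x)
    fun y => (hasGradientAt_gradY h.contDiff_g x y).differentiableAt)

theorem gradY_lowerSol (h : IsSCSC S c f g xstar) (x : Vec p) : gradY g x (lowerSol g x) = 0 :=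
  IsMinOn.hasGradientAt_eq_zero (h.isMinOn_lowerSol x) (hasGradientAt_gradY h.contDiff_g x _)

/-- Strong monotonicity of `∇_y g(x₁, ·)` bounds the distance by `‖∇_y g(x₁, y*(x₂))‖ / μ_y`, and
this gradient would vanish if `x₁` were replaced by `x₂`. -/
theorem norm_lowerSol_sub_le (h : IsSCSC S c f g xstar) (x₁ x₂ : Vec p) :
    ‖lowerSol g x₁ - lowerSol g x₂‖ ≤ S.tLxy / c.muy * ‖x₁ - x₂‖ := by
  have h1 := StrongConvexOn.mul_norm_sub_le (h.strongConvex_g x₁)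
    (hasGradientAt_gradY h.contDiff_g x₁ (lowerSol g x₁))
    (hasGradientAt_gradY h.contDiff_g x₁ (lowerSol g x₂))
  have h2 := h.gradY_g_lip_x x₂ x₁ (lowerSol g x₂)
  rw [h.gradY_lowerSol, norm_sub_rev x₂] at h2
  rw [h.gradY_lowerSol] at h1
  rw [div_mul_eq_mul_div, le_div_iff₀ h.muy_pos]
  linarith

theorem inner_hess_symm (h : IsSCSC S c f g xstar) (x : Vec p) (y v w : Vec q) :
    ⟪hessY g x y v, w⟫_ℝ = ⟪v, hessY g x y w⟫_ℝ := by
  have h1 : ∀ y, HasFDerivAt (g x) (InnerProductSpace.toDual ℝ (Vec q) (gradY g x y)) y :=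
    fun y => (hasGradientAt_gradY h.contDiff_g x y).hasFDerivAt
  let D : Vec q →L[ℝ] (Vec q →L[ℝ] ℝ) := innerSL ℝ
  have h2 : HasFDerivAt (fun y => InnerProductSpace.toDual ℝ (Vec q) (gradY g x y))
      (D.comp (hessY g x y)) y :=
    D.hasFDerivAt.comp y (h.hasFDerivAt_hess x y)
  have h3 : ⟪hessY g x y v, w⟫_ℝ = ⟪hessY g x y w, v⟫_ℝ := second_derivative_symmetric h1 h2 v w
  rw [h3, real_inner_comm]

/-- The limit of strong monotonicity of `∇_y g(x, ·)` between `y` and `y + t v`, divided by `t²`. -/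
theorem mul_sq_norm_le_inner_hess (h : IsSCSC S c f g xstar) (x : Vec p) (y v : Vec q) :
    c.muy * ‖v‖ ^ 2 ≤ ⟪hessY g x y v, v⟫_ℝ := by
  have h1 : HasDerivAt (fun t : ℝ => y + t • v) v 0 := by
    simpa using ((hasDerivAt_id (0 : ℝ)).smul_const v).const_add y
  have h2 : HasDerivAt (fun t : ℝ => gradY g x (y + t • v)) (hessY g x y v) 0 := by
    have := h.hasFDerivAt_hess x (y + (0 : ℝ) • v)
    have h3 := this.comp_hasDerivAt (0 : ℝ) h1
    simpa [Function.comp_def] using h3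
  have h3 := h2.tendsto_slope_zero_right
  have h4 : Filter.Tendsto (fun t : ℝ => ⟪t⁻¹ • (gradY g x (y + (0 + t) • v)
      - gradY g x (y + (0 : ℝ) • v)), v⟫_ℝ) (nhdsWithin 0 (Ioi 0)) (nhds ⟪hessY g x y v, v⟫_ℝ) :=
    h3.inner tendsto_const_nhds
  refine ge_of_tendsto h4 ?_
  filter_upwards [self_mem_nhdsWithin] with t ht
  have ht : 0 < t := ht
  have h5 := StrongConvexOn.le_inner_sub (h.strongConvex_g x)
    (hasGradientAt_gradY h.contDiff_g x (y + t • v)) (hasGradientAt_gradY h.contDiff_g x y)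
  rw [add_sub_cancel_left, norm_smul, inner_smul_right, Real.norm_of_nonneg ht.le] at h5
  rw [zero_add, zero_smul, add_zero, inner_smul_left, conj_trivial, le_inv_mul_iff₀ ht]
  have : t * (t * (c.muy * ‖v‖ ^ 2))
    ≤ t * ⟪gradY g x (y + t • v) - gradY g x y, v⟫_ℝ := by nlinarith
  exact le_of_mul_le_mul_left this ht

theorem norm_hess_le (h : IsSCSC S c f g xstar) (x : Vec p) (y : Vec q) :
    ‖hessY g x y‖ ≤ c.tLy :=
  (h.hasFDerivAt_hess x y).le_of_lip' h.tLy_nonneg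
    (Filter.Eventually.of_forall fun y' => h.gradY_g_lip_y x y' y)

theorem inner_hess_le (h : IsSCSC S c f g xstar) (x : Vec p) (y v : Vec q) :
    ⟪hessY g x y v, v⟫_ℝ ≤ c.tLy * ‖v‖ ^ 2 := by
  refine (real_inner_le_norm _ _).trans ?_
  have := (hessY g x y).le_of_opNorm_le (h.norm_hess_le x y) v
  nlinarith [norm_nonneg v]

theorem mul_norm_le_norm_hess (h : IsSCSC S c f g xstar) (x : Vec p) (y v : Vec q) :
    c.muy * ‖v‖ ≤ ‖hessY g x y v‖ := by
  rcases (norm_nonneg v).eq_or_lt with hv | hv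
  · rw [← hv]; simp
  · have h1 := h.mul_sq_norm_le_inner_hess x y v
    have h2 := real_inner_le_norm (hessY g x y v) v
    have : c.muy * ‖v‖ * ‖v‖ ≤ ‖hessY g x y v‖ * ‖v‖ := by nlinarith
    exact le_of_mul_le_mul_right this hv

theorem norm_jac_le (h : IsSCSC S c f g xstar) (x : Vec p) (y : Vec q) :
    ‖jacXY g x y‖ ≤ S.tLxy := by
  rw [jacXY, LinearIsometryEquiv.norm_map]
  exact (h.hasFDerivAt_jac x y).le_of_lip' h.tLxy_nonneg
    (Filter.Eventually.of_forall fun x' => h.gradY_g_lip_x x' x y)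

/-- Coercivity makes the Hessian injective, hence invertible in finite dimension; thus `inverse` in
`hessSolve` is a true inverse and not its default value. -/
theorem exists_hess_equiv (h : IsSCSC S c f g xstar) (x : Vec p) (y : Vec q) :
    ∃ e : Vec q ≃L[ℝ] Vec q, (e : Vec q →L[ℝ] Vec q) = hessY g x y := by
  have hinj : Function.Injective (hessY g x y : Vec q →ₗ[ℝ] Vec q) := by
    rw [← LinearMap.ker_eq_bot, LinearMap.ker_eq_bot']
    intro v hv
    have h1 := h.mul_norm_le_norm_hess x y v
    have hv' : hessY g x y v = 0 := hv
    rw [hv', norm_zero] at h1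
    exact norm_le_zero_iff.1 (nonpos_of_mul_nonpos_right h1 h.muy_pos)
  refine ⟨(LinearEquiv.ofInjectiveEndo _ hinj).toContinuousLinearEquiv, ?_⟩
  ext v
  rfl

theorem hess_hessSolve (h : IsSCSC S c f g xstar) (x : Vec p) (y b : Vec q) :
    hessY g x y (hessSolve g x y b) = b := by
  obtain ⟨e, he⟩ := h.exists_hess_equiv x y
  rw [hessSolve, ← he, ContinuousLinearMap.inverse_equiv]
  simp

theorem hessSolve_hess (h : IsSCSC S c f g xstar) (x : Vec p) (y v : Vec q) :
    hessSolve g x y (hessY g x y v) = v := by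
  obtain ⟨e, he⟩ := h.exists_hess_equiv x y
  rw [hessSolve, ← he, ContinuousLinearMap.inverse_equiv]
  simp

theorem norm_hessSolve_le (h : IsSCSC S c f g xstar) (x : Vec p) (y b : Vec q) :
    ‖hessSolve g x y b‖ ≤ ‖b‖ / c.muy := by
  have := h.mul_norm_le_norm_hess x y (hessSolve g x y b)
  rw [h.hess_hessSolve] at this
  rw [le_div_iff₀ h.muy_pos]; linarith

/-- Applying the first Hessian to `v₁ - v₂` leaves `(b₁ - b₂) - (H₁ - H₂) v₂`. The Hessian variation
meets `v₂` only, so the bound involves `‖b₂‖` and not `‖b₁‖`. -/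
theorem norm_hessSolve_sub_le (h : IsSCSC S c f g xstar) (x₁ x₂ : Vec p) (y₁ y₂ b₁ b₂ : Vec q) :
    ‖hessSolve g x₁ y₁ b₁ - hessSolve g x₂ y₂ b₂‖
      ≤ (‖b₁ - b₂‖ + c.rhoyy * pairNorm (x₁ - x₂) (y₁ - y₂) * (‖b₂‖ / c.muy)) / c.muy := by
  set v₁ := hessSolve g x₁ y₁ b₁ with hv₁
  set v₂ := hessSolve g x₂ y₂ b₂ with hv₂
  have h1 := h.mul_norm_le_norm_hess x₁ y₁ (v₁ - v₂)
  have h2 : hessY g x₁ y₁ (v₁ - v₂) = (b₁ - b₂) - (hessY g x₁ y₁ - hessY g x₂ y₂) v₂ := by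
    rw [map_sub, hv₁, h.hess_hessSolve, sub_apply,
      h.hess_hessSolve]
    abel
  rw [h2] at h1
  have h3 := (hessY g x₁ y₁ - hessY g x₂ y₂).le_of_opNorm_le (h.hessY_g_lip x₁ x₂ y₁ y₂) v₂
  have h4 := h.norm_hessSolve_le x₂ y₂ b₂
  have h5 : 0 ≤ c.rhoyy * pairNorm (x₁ - x₂) (y₁ - y₂) :=
    mul_nonneg h.rhoyy_nonneg (Real.sqrt_nonneg _)
  have h6 := mul_le_mul_of_nonneg_left h4 h5
  have h7 := norm_sub_le (b₁ - b₂) ((hessY g x₁ y₁ - hessY g x₂ y₂) v₂)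
  rw [le_div_iff₀ h.muy_pos]
  linarith

/-- Along the Lipschitz curve `x' ↦ (x', y*(x'))` the linearization error of `∇_y g` is `o(x' - x)`,
while `∇_y g` itself vanishes. Applying the inverse Hessian to that error yields the derivative, so
no implicit function theorem is needed. -/
theorem hasFDerivAt_lowerSol (h : IsSCSC S c f g xstar) (x : Vec p) :
    HasFDerivAt (lowerSol g) (-((hessY g x (lowerSol g x)).inverse.comp
      (fderiv ℝ (fun x' => gradY g x' (lowerSol g x)) x))) x := by
  set y := lowerSol g x with hy
  have hcont : Filter.Tendsto (fun x' => (x', lowerSol g x')) (nhds x) (nhds (x, y)) := by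
    refine Filter.Tendsto.prodMk_nhds Filter.tendsto_id ?_
    have hlip : LipschitzWith (S.tLxy / c.muy).toNNReal (lowerSol g) := by
      refine LipschitzWith.of_dist_le_mul fun a b => ?_
      rw [dist_eq_norm, dist_eq_norm, Real.coe_toNNReal _
        (div_nonneg h.tLxy_nonneg h.muy_pos.le)]
      exact h.norm_lowerSol_sub_le a b
    exact hlip.continuous.tendsto x
  have h1 := (h.differentiable_gradY_g (x, y)).hasFDerivAt.isLittleO.comp_tendsto hcont
  have h2 : (fun x' => (x', lowerSol g x') - (x, y)) =O[nhds x] fun x' => x' - x := by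
    refine Asymptotics.IsBigO.of_bound (max 1 (S.tLxy / c.muy))
      (Filter.Eventually.of_forall fun x' => ?_)
    rw [Prod.mk_sub_mk, Prod.norm_mk]
    refine max_le ?_ ?_
    · exact le_mul_of_one_le_left (norm_nonneg _) (le_max_left _ _)
    · exact (h.norm_lowerSol_sub_le x' x).trans
        (mul_le_mul_of_nonneg_right (le_max_right _ _) (norm_nonneg _))
  have h3 := h1.trans_isBigO h2
  have h4 := ((hessY g x y).inverse.isBigO_comp _ (nhds x)).trans_isLittleO h3
  rw [hasFDerivAt_iff_isLittleO]
  refine (h4.neg_left).congr_left fun x' => ?_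
  simp only [Function.comp_apply, Prod.mk_sub_mk]
  rw [h.fderiv_gradY_apply, hy, h.gradY_lowerSol, h.gradY_lowerSol, ← hy]
  have h5 := h.hessSolve_hess x y (lowerSol g x' - y)
  rw [hessSolve] at h5
  rw [map_sub, map_sub, map_add, h5]
  simp only [map_zero, neg_apply, map_sub, ContinuousLinearMap.comp_apply]
  abel

/-- The chain rule puts the inverse Hessian on the direction `u`; its symmetry and the adjoint in
`jacXY` move it onto `∇_y f`. -/
theorem hasGradientAt_Phi (h : IsSCSC S c f g xstar) (x : Vec p) :
    HasGradientAt (Phi f g) (hyperGradient f g x) x := by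
  have h1 := ((h.contDiff_f.differentiable one_ne_zero) (x, lowerSol g x)).hasFDerivAt
  have h2 := HasFDerivAt.comp (f := fun x' => (x', lowerSol g x')) x h1
    ((hasFDerivAt_id x).prodMk (h.hasFDerivAt_lowerSol x))
  rw [hasGradientAt_iff_hasFDerivAt]
  refine HasFDerivAt.congr_fderiv h2 ?_
  ext u
  simp only [ContinuousLinearMap.comp_apply, ContinuousLinearMap.prod_apply]
  rw [fderiv_prod_apply h.contDiff_f, InnerProductSpace.toDual_apply_apply, hyperGradient,
    inner_sub_left]
  set A := fderiv ℝ (fun x' => gradY g x' (lowerSol g x)) x with hA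
  set y := lowerSol g x
  set b := gradY f x y
  have h3 : ⟪jacXY g x y (hessSolve g x y b), u⟫_ℝ = ⟪hessSolve g x y b, A u⟫_ℝ :=
    ContinuousLinearMap.adjoint_inner_left A u _
  have h4 : ⟪hessSolve g x y b, A u⟫_ℝ = ⟪b, hessSolve g x y (A u)⟫_ℝ := by
    conv_lhs => rw [← h.hess_hessSolve x y (A u)]
    rw [← h.inner_hess_symm, h.hess_hessSolve]
  rw [h3, h4, hessSolve]
  simp [sub_eq_add_neg]

/-- The Lipschitz bound of the gradient of `Φ`, with base `x₂`. -/
theorem norm_hyperGradient_sub_le (h : IsSCSC S c f g xstar) (x₁ x₂ : Vec p) :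
    ‖hyperGradient f g x₁ - hyperGradient f g x₂‖
      ≤ (S.Lx + 2 * S.Lxy * S.tLxy / c.muy + S.Ly * S.tLxy ^ 2 / c.muy ^ 2
        + (S.tLxy * c.rhoyy / c.muy ^ 2 + c.rhoxy / c.muy) * (1 + S.tLxy / c.muy)
          * ‖gradY f x₂ (lowerSol g x₂)‖) * ‖x₁ - x₂‖ := by
  have hm := h.muy_pos
  have := h.Lx_nonneg
  have hLxy := h.Lxy_nonneg
  have hLy := h.Ly_nonneg
  have htL := h.tLxy_nonneg
  have hr1 := h.rhoxy_nonneg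
  have hr2 := h.rhoyy_nonneg
  set y₁ := lowerSol g x₁ with hy₁
  set y₂ := lowerSol g x₂ with hy₂
  set d := ‖x₁ - x₂‖ with hd
  have hd0 : 0 ≤ d := norm_nonneg _
  set r := S.tLxy / c.muy with hr
  have hr0 : 0 ≤ r := div_nonneg htL hm.le
  set B := ‖gradY f x₂ y₂‖ with hB
  have hB0 : 0 ≤ B := norm_nonneg _
  have hyd : ‖y₁ - y₂‖ ≤ r * d := h.norm_lowerSol_sub_le x₁ x₂
  have hpn : pairNorm (x₁ - x₂) (y₁ - y₂) ≤ (1 + r) * d := by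
    have := pairNorm_le_add (x₁ - x₂) (y₁ - y₂)
    linarith
  have hfx : ‖gradX f x₁ y₁ - gradX f x₂ y₂‖ ≤ (S.Lx + S.Lxy * r) * d := by
    have h1 := h.gradX_f_lip_x x₁ x₂ y₁
    have h2 := h.gradX_f_lip_y x₂ y₁ y₂
    have h3 := mul_le_mul_of_nonneg_left hyd hLxy
    have h4 := norm_sub_le_norm_sub_add_norm_sub (gradX f x₁ y₁) (gradX f x₂ y₁) (gradX f x₂ y₂)
    linarith
  have hfy : ‖gradY f x₁ y₁ - gradY f x₂ y₂‖ ≤ (S.Lxy + S.Ly * r) * d := by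
    have h1 := h.gradY_f_lip_x x₁ x₂ y₁
    have h2 := h.gradY_f_lip_y x₂ y₁ y₂
    have h3 := mul_le_mul_of_nonneg_left hyd hLy
    have h4 := norm_sub_le_norm_sub_add_norm_sub (gradY f x₁ y₁) (gradY f x₂ y₁) (gradY f x₂ y₂)
    linarith
  have hv := h.norm_hessSolve_sub_le x₁ x₂ y₁ y₂ (gradY f x₁ y₁) (gradY f x₂ y₂)
  have hv2 := h.norm_hessSolve_le x₂ y₂ (gradY f x₂ y₂)
  set v₁ := hessSolve g x₁ y₁ (gradY f x₁ y₁)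
  set v₂ := hessSolve g x₂ y₂ (gradY f x₂ y₂)
  rw [← hB] at hv2 hv
  have hv' : ‖v₁ - v₂‖
      ≤ ((S.Lxy + S.Ly * r) * d + c.rhoyy * ((1 + r) * d) * (B / c.muy)) / c.muy := by
    refine hv.trans ?_
    gcongr
  have hJ1 : ‖jacXY g x₁ y₁ (v₁ - v₂)‖
      ≤ S.tLxy * (((S.Lxy + S.Ly * r) * d + c.rhoyy * ((1 + r) * d) * (B / c.muy)) / c.muy) :=
    ((jacXY g x₁ y₁).le_of_opNorm_le (h.norm_jac_le x₁ y₁) _).trans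
      (mul_le_mul_of_nonneg_left hv' htL)
  have hJ2 : ‖(jacXY g x₁ y₁ - jacXY g x₂ y₂) v₂‖ ≤ c.rhoxy * ((1 + r) * d) * (B / c.muy) := by
    refine ((jacXY g x₁ y₁ - jacXY g x₂ y₂).le_of_opNorm_le (h.jacXY_g_lip x₁ x₂ y₁ y₂) _).trans ?_
    gcongr
  -- The Jacobian at `x₁` meets `v₁ - v₂` and the Jacobian variation meets `v₂`, so `‖∇_y f‖` is
  -- needed at `x₂` only.
  have hsplit : hyperGradient f g x₁ - hyperGradient f g x₂
      = (gradX f x₁ y₁ - gradX f x₂ y₂)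
        - (jacXY g x₁ y₁ (v₁ - v₂) + (jacXY g x₁ y₁ - jacXY g x₂ y₂) v₂) := by
    simp only [hyperGradient, sub_apply, map_sub]
    rw [← hy₁, ← hy₂]
    abel
  rw [hsplit]
  refine (norm_sub_le _ _).trans ?_
  refine (add_le_add hfx ((norm_add_le _ _).trans (add_le_add hJ1 hJ2))).trans (le_of_eq ?_)
  rw [hr]
  field_simp
  ring

theorem norm_gradY_lowerSol_le (h : IsSCSC S c f g xstar) (x : Vec p) :
    ‖gradY f x (lowerSol g x)‖ ≤ ‖gradY f xstar (lowerSol g xstar)‖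
      + (S.Lxy + S.Ly * S.tLxy / c.muy) * ‖x - xstar‖ := by
  have h1 := h.gradY_f_lip_x x xstar (lowerSol g x)
  have h2 := h.gradY_f_lip_y xstar (lowerSol g x) (lowerSol g xstar)
  have h3 := mul_le_mul_of_nonneg_left (h.norm_lowerSol_sub_le x xstar) h.Ly_nonneg
  have h4 := norm_sub_le_norm_sub_add_norm_sub (gradY f x (lowerSol g x))
    (gradY f xstar (lowerSol g x)) (gradY f xstar (lowerSol g xstar))
  have h5 := norm_le_norm_add_norm_sub (gradY f xstar (lowerSol g xstar))
    (gradY f x (lowerSol g x))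
  rw [norm_sub_rev] at h5
  have h6 : S.Ly * (S.tLxy / c.muy * ‖x - xstar‖) = S.Ly * S.tLxy / c.muy * ‖x - xstar‖ := by ring
  rw [add_mul]
  linarith

/-- The gradient of `Φ` satisfies the Lipschitz bound with constant `L_Φ` and base `x₂`, if `x₂` is
not too far from the minimizer. -/
theorem norm_hyperGradient_sub_le_LPhi (h : IsSCSC S c f g xstar) {ε : ℝ} {x₂ : Vec p}
    (hx : ‖x₂ - xstar‖ ≤ 3 * √(2 / c.mux * (Phi f g 0 - Phi f g xstar) + ‖xstar‖ ^ 2 + ε / c.mux))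
    (x₁ : Vec p) :
    ‖hyperGradient f g x₁ - hyperGradient f g x₂‖ ≤ LPhi S c f g xstar ε * ‖x₁ - x₂‖ := by
  refine (h.norm_hyperGradient_sub_le x₁ x₂).trans
    (mul_le_mul_of_nonneg_right ?_ (norm_nonneg _))
  have hm := h.muy_pos
  have hLxy := h.Lxy_nonneg
  have hLy := h.Ly_nonneg
  have htL := h.tLxy_nonneg
  have hr1 := h.rhoxy_nonneg
  have hr2 := h.rhoyy_nonneg
  set R := √(2 / c.mux * (Phi f g 0 - Phi f g xstar) + ‖xstar‖ ^ 2 + ε / c.mux)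
  have h1 : ‖gradY f x₂ (lowerSol g x₂)‖ ≤ ‖gradY f xstar (lowerSol g xstar)‖
      + (S.Lxy + S.Ly * S.tLxy / c.muy) * (3 * R) := by
    refine (h.norm_gradY_lowerSol_le x₂).trans ?_
    gcongr
  have h2 : 0 ≤ (S.tLxy * c.rhoyy / c.muy ^ 2 + c.rhoxy / c.muy) * (1 + S.tLxy / c.muy) := by
    positivity
  have h3 := mul_le_mul_of_nonneg_left h1 h2
  rw [LPhi]
  linarith

end IsSCSC

/-! ### Oracle counts. -/

section Count

variable {α β : Type}

theorem iter_succ (step : α → Counted α) (n : ℕ) (a : α) :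
    iter step (n + 1) a = iter step n a >>= step := rfl

theorem bind_count (m : Counted α) (k : α → Counted β) :
    (m >>= k).count = ⟨m.count.nG + (k m.val).count.nG, m.count.nJ + (k m.val).count.nJ,
      m.count.nH + (k m.val).count.nH⟩ := rfl

theorem iter_count {step : α → Counted α} {o : OracleCount} (hstep : ∀ a, (step a).count = o)
    (n : ℕ) (a : α) : (iter step n a).count = ⟨n * o.nG, n * o.nJ, n * o.nH⟩ := by
  induction n with
  | zero => simp only [zero_mul]; rfl
  | succ n ih => rw [iter_succ, bind_count, ih, hstep]; simp only [add_mul, one_mul]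

end Count

variable {p q : ℕ}

theorem agd_count (c : CondParams) (g : Vec p → Vec q → ℝ) (x : Vec p) (N : ℕ) :
    (agd c g x N).count = ⟨N, 0, 0⟩ := by
  have h : (agd c g x N).count = (iter (agdStep c g x) N (0, 0)).count := rfl
  rw [h, iter_count (o := ⟨1, 0, 0⟩) fun _ => rfl]
  simp

theorem heavyBall_count (c : CondParams) (g : Vec p → Vec q → ℝ) (x : Vec p) (y b : Vec q)
    (M : ℕ) : (heavyBall c g x y b M).count = ⟨0, 0, M - 1⟩ := by
  have h : (heavyBall c g x y b M).count = (iter (hbIter c g x y b) (M - 1) (0, 0)).count := rfl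
  rw [h, iter_count (o := ⟨0, 0, 1⟩) fun _ => rfl]
  simp

theorem hypergrad_count (c : CondParams) (f g : Vec p → Vec q → ℝ) (N M : ℕ) (x : Vec p) :
    (hypergrad c f g N M x).count = ⟨N + 2, 1, M - 1⟩ := by
  simp only [hypergrad, bind_count, agd_count, heavyBall_count, queryGradX, queryGradY, queryJac]
  simp only [pure]
  congr 1
  all_goals omega

theorem outerStep_count (c : CondParams) (f g : Vec p → Vec q → ℝ) (L : ℝ) (N M : ℕ)
    (w : Vec p × Vec p) : (outerStep c f g L N M w).count = ⟨N + 2, 1, M - 1⟩ := by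
  simp only [outerStep, bind_count, hypergrad_count]
  simp only [pure]
  rfl

theorem accBiO_count (c : CondParams) (f g : Vec p → Vec q → ℝ) (L : ℝ) (N M K : ℕ) :
    (accBiO c f g L N M K).count = ⟨K * (N + 2), K, K * (M - 1)⟩ := by
  rw [accBiO, iter_count (outerStep_count c f g L N M)]
  simp

/-! ### Linear rates of the two inner loops. -/

theorem one_sub_div_one_add {a : ℝ} (ha : 0 < a) :
    (1 - 1 / a) / (1 + 1 / a) = (a - 1) / (a + 1) := by
  have : a + 1 ≠ 0 := by positivity
  field_simp

namespace IsSCSC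

variable {S : SmoothConsts} {c : CondParams} {f g : Vec p → Vec q → ℝ} {xstar : Vec p}

/-- The two Hessian bounds are tested on a unit vector, which exists because `q > 0`. -/
theorem muy_le_tLy (h : IsSCSC S c f g xstar) (hq : 0 < q) : c.muy ≤ c.tLy := by
  have h1 := h.mul_sq_norm_le_inner_hess 0 0 (EuclideanSpace.single ⟨0, hq⟩ 1)
  have h2 := h.inner_hess_le 0 0 (EuclideanSpace.single ⟨0, hq⟩ 1)
  have h3 : ‖(EuclideanSpace.single ⟨0, hq⟩ 1 : Vec q)‖ = 1 := by simp
  rw [h3] at h1 h2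
  linarith

theorem one_le_kappay (h : IsSCSC S c f g xstar) (hq : 0 < q) : 1 ≤ c.kappay := by
  rw [CondParams.kappay, one_le_div h.muy_pos]
  exact h.muy_le_tLy hq

/-- The linear rate of the lower-level accelerated gradient descent. -/
theorem sq_norm_agd_sub_le (h : IsSCSC S c f g xstar) (hq : 0 < q) (x : Vec p) (N : ℕ) :
    ‖(agd c g x N).val - lowerSol g x‖ ^ 2
      ≤ (1 - 1 / √c.kappay) ^ N * ((c.kappay + 1) * ‖lowerSol g x‖ ^ 2) := by
  have hκ := h.one_le_kappay hq
  have hs : 1 ≤ √c.kappay := Real.one_le_sqrt.2 hκ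
  have hs0 : 0 < √c.kappay := by linarith
  have hL : 0 < c.tLy := h.muy_pos.trans_le (h.muy_le_tLy hq)
  let w : ℕ → Vec q × Vec q := fun n => (iter (agdStep c g x) n (0, 0)).val
  have key := nesterov_sq_norm_sub_le (f := g x) (f' := gradY g x) (m := c.muy) (L := c.tLy)
    (α := 1 / √c.kappay) (xs := lowerSol g x) (x := fun n => (w n).2) (z := fun n => (w n).1)
    h.muy_pos hL (by positivity) ((div_le_one hs0).2 hs) ?_ (h.strongConvex_g x)
    (fun y => hasGradientAt_gradY h.contDiff_g x y) (fun u v => h.gradY_g_lip_y x u v)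
    (h.isMinOn_lowerSol x) rfl rfl (fun n => rfl) ?_ N
  · exact key
  · rw [div_pow, Real.sq_sqrt (by linarith), CondParams.kappay]
    have := h.muy_pos
    field_simp
  · intro n
    rw [one_sub_div_one_add hs0]
    have h1 : 1 + (√c.kappay - 1) / (√c.kappay + 1) = 2 * √c.kappay / (√c.kappay + 1) := by
      have : √c.kappay + 1 ≠ 0 := by positivity
      field_simp; ring
    rw [h1]
    rfl

/-- With `β = (√κ_y - 1) / (√κ_y + 1)` the step size satisfies `λ μ_y = (1 - β)²` and `λ L̃_y = (1 +
β)²`, and the momentum is `β²`. The errors then follow the two-term recursion with `T = (1 + β²) - λ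
H`, whose quadratic form lies between `±2 β ‖v‖²`. -/
theorem norm_heavyBall_sub_le (h : IsSCSC S c f g xstar) (hq : 0 < q) (x : Vec p) (y b : Vec q)
    (n : ℕ) :
    ‖(heavyBall c g x y b (n + 1)).val - hessSolve g x y b‖
      ≤ (2 * n + 1) * ((√c.kappay - 1) / (√c.kappay + 1)) ^ n * ‖hessSolve g x y b‖ := by
  have hm := h.muy_pos
  have hmL := h.muy_le_tLy hq
  have hL : 0 < c.tLy := hm.trans_le hmL
  set a := √c.tLy with ha
  set d := √c.muy with hd
  have hd0 : 0 < d := Real.sqrt_pos.2 hm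
  have hda : d ≤ a := Real.sqrt_le_sqrt hmL
  have ha0 : 0 < a := by linarith
  have ha2 : a ^ 2 = c.tLy := Real.sq_sqrt hL.le
  have hd2 : d ^ 2 = c.muy := Real.sq_sqrt hm.le
  set β := (a - d) / (a + d) with hβ
  have hβκ : (√c.kappay - 1) / (√c.kappay + 1) = β := by
    rw [CondParams.kappay, Real.sqrt_div hL.le, ← ha, ← hd, hβ]
    have : a + d ≠ 0 := by positivity
    field_simp
  have hβ0 : 0 ≤ β := div_nonneg (by linarith) (by linarith)
  have hβ1 : β ≤ 1 := by rw [hβ, div_le_one (by linarith)]; linarith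
  have hstep : c.hbStep = 4 / (a + d) ^ 2 := rfl
  have hμ : c.hbStep * c.muy = (1 - β) ^ 2 := by
    rw [hstep, hβ, ← hd2]; field_simp; ring
  have hLL : c.hbStep * c.tLy = (1 + β) ^ 2 := by
    rw [hstep, hβ, ← ha2]; field_simp; ring
  have hθ : c.hbMomentum = β ^ 2 := by
    rw [CondParams.hbMomentum, hμ, hLL, Real.sqrt_sq (by linarith), Real.sqrt_sq (by linarith)]
    ring_nf
    exact max_self _
  have hstep0 : 0 ≤ c.hbStep := by rw [hstep]; positivity
  set vs := hessSolve g x y b with hvs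
  have hHvs : hessY g x y vs = b := h.hess_hessSolve x y b
  let w : ℕ → Vec q × Vec q := fun n => (iter (hbIter c g x y b) n (0, 0)).val
  let T : Vec q →L[ℝ] Vec q :=
    (1 + β ^ 2) • ContinuousLinearMap.id ℝ (Vec q) - c.hbStep • hessY g x y
  have hT : ∀ v, T v = (1 + β ^ 2) • v - c.hbStep • hessY g x y v := fun v => rfl
  have hw1 : ∀ n, (w (n + 1)).1 = (w n).2 := fun n => rfl
  have hw2 : ∀ n, (w (n + 1)).2 = (w n).2 - c.hbStep • (hessY g x y (w n).2 - b)
    + c.hbMomentum • ((w n).2 - (w n).1) := fun n => rfl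
  have key := norm_le_of_two_term_recursion (S := T) hβ0 hβ1 ?_ ?_
    -- Here `e n` is the error of `v^n`, and `e 1 = e 0` since `v^0 = v^1`. The output `v^(n+1)` is
    -- the second component after `n` updates.
    (e := fun n => (w n).1 - vs) rfl ?_ n
  · rw [hβκ]
    refine key.trans (le_of_eq ?_)
    have : (w 0).1 - vs = - vs := by
      have : (w 0).1 = 0 := rfl
      rw [this, zero_sub]
    simp only [this, norm_neg]
  · intro v u
    rw [hT, hT]
    simp only [inner_sub_left, inner_sub_right, inner_smul_left, inner_smul_right, conj_trivial]
    rw [h.inner_hess_symm]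
  · intro v
    rw [hT]
    simp only [inner_sub_left, inner_smul_left, conj_trivial, real_inner_self_eq_norm_sq]
    have h1 := mul_le_mul_of_nonneg_left (h.mul_sq_norm_le_inner_hess x y v) hstep0
    have h2 := mul_le_mul_of_nonneg_left (h.inner_hess_le x y v) hstep0
    rw [← mul_assoc, hμ] at h1
    rw [← mul_assoc, hLL] at h2
    rw [abs_le]
    constructor <;> linarith
  · intro n
    change (w (n + 1 + 1)).1 - vs = T ((w (n + 1)).1 - vs) - β ^ 2 • ((w n).1 - vs)
    rw [hw1, hw1, hw2, hT, hθ, map_sub, hHvs]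
    module

end IsSCSC

/-! ### Polynomial bounds in a single parameter. -/

/-- `Y` bounds all the parameters of the problem. -/
structure IsParamBound {p q : ℕ} (S : SmoothConsts) (c : CondParams) (f g : Vec p → Vec q → ℝ)
    (xstar : Vec p) (ε Y : ℝ) : Prop where
  two_le : 2 ≤ Y
  Lx_le : S.Lx ≤ Y
  Lxy_le : S.Lxy ≤ Y
  Ly_le : S.Ly ≤ Y
  tLxy_le : S.tLxy ≤ Y
  tLy_le : c.tLy ≤ Y
  rhoxy_le : c.rhoxy ≤ Y
  rhoyy_le : c.rhoyy ≤ Y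
  inv_mux_le : 1 / c.mux ≤ Y
  inv_muy_le : 1 / c.muy ≤ Y
  norm_xstar_le : ‖xstar‖ ≤ Y
  norm_lowerSol_le : ‖lowerSol g xstar‖ ≤ Y
  norm_gradY_le : ‖gradY f xstar (lowerSol g xstar)‖ ≤ Y
  gap_le : Phi f g 0 - Phi f g xstar ≤ Y
  eps_le : ε ≤ Y
  inv_eps_le : 1 / ε ≤ Y

/-- The iterates of AccBiO stay at distance at most three times this radius from the minimizer. -/
noncomputable def radius {p q : ℕ} (c : CondParams) (f g : Vec p → Vec q → ℝ) (xstar : Vec p)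
    (ε : ℝ) : ℝ :=
  √(2 / c.mux * (Phi f g 0 - Phi f g xstar) + ‖xstar‖ ^ 2 + ε / c.mux)

/-- Since `Y ≥ 2`, a numerical constant up to `2 ^ j` is absorbed into `j` further powers of `Y`.
The exponents below are generous, as only their logarithmic cost matters. -/
theorem const_mul_pow_le {Y k : ℝ} (hY : 2 ≤ Y) {a b j : ℕ} (hk : k ≤ 2 ^ j) (hab : a + j ≤ b) :
    k * Y ^ a ≤ Y ^ b :=
  calc k * Y ^ a ≤ Y ^ j * Y ^ a := by gcongr; exact hk.trans (by gcongr)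
    _ = Y ^ (a + j) := by rw [pow_add, mul_comm]
    _ ≤ Y ^ b := pow_le_pow_right₀ (by linarith) hab

theorem pairNorm_zero_left {p q : ℕ} (y : Vec q) : pairNorm (0 : Vec p) y = ‖y‖ := by
  simp [pairNorm]

namespace IsSCSC

variable {p q : ℕ} {S : SmoothConsts} {c : CondParams} {f g : Vec p → Vec q → ℝ} {xstar : Vec p}
  {ε Y : ℝ}

theorem Phi_xstar_le (h : IsSCSC S c f g xstar) (x : Vec p) : Phi f g xstar ≤ Phi f g x :=
  h.isMin_xstar (mem_univ x)

theorem radius_le (h : IsSCSC S c f g xstar) (hY : IsParamBound S c f g xstar ε Y) :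
    radius c f g xstar ε ≤ 2 * Y := by
  have h2 := hY.two_le
  rw [radius, Real.sqrt_le_left (by linarith)]
  have h1 : 0 < 1 / c.mux := one_div_pos.2 h.mux_pos
  have h3 : 2 / c.mux * (Phi f g 0 - Phi f g xstar) ≤ 2 * (Y * Y) := by
    rw [div_eq_mul_one_div, mul_assoc]
    have := mul_le_mul hY.inv_mux_le hY.gap_le (sub_nonneg.2 (h.Phi_xstar_le 0)) (by linarith)
    linarith
  have h4 : ε / c.mux ≤ Y * Y := by
    rw [div_eq_mul_one_div]
    exact mul_le_mul hY.eps_le hY.inv_mux_le h1.le (by linarith)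
  have h5 : ‖xstar‖ ^ 2 ≤ Y ^ 2 := pow_le_pow_left₀ (norm_nonneg _) hY.norm_xstar_le 2
  nlinarith

theorem kappay_le (h : IsSCSC S c f g xstar) (hY : IsParamBound S c f g xstar ε Y) :
    c.kappay ≤ Y ^ 2 := by
  have h1 : 0 < 1 / c.muy := one_div_pos.2 h.muy_pos
  rw [CondParams.kappay, div_eq_mul_one_div, sq]
  exact mul_le_mul hY.tLy_le hY.inv_muy_le h1.le (by linarith [hY.two_le])

theorem ratio_le (h : IsSCSC S c f g xstar) (hY : IsParamBound S c f g xstar ε Y) :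
    S.tLxy / c.muy ≤ Y ^ 2 := by
  have h1 : 0 < 1 / c.muy := one_div_pos.2 h.muy_pos
  rw [div_eq_mul_one_div, sq]
  exact mul_le_mul hY.tLxy_le hY.inv_muy_le h1.le (by linarith [hY.two_le])

theorem LPhi_le (h : IsSCSC S c f g xstar) (hY : IsParamBound S c f g xstar ε Y) :
    LPhi S c f g xstar ε ≤ Y ^ 17 := by
  have h2 := hY.two_le
  have hR := h.radius_le hY
  have hR0 : 0 ≤ radius c f g xstar ε := Real.sqrt_nonneg _
  have hμ : 0 < 1 / c.muy := one_div_pos.2 h.muy_pos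
  have hμY := hY.inv_muy_le
  have hLx := h.Lx_nonneg
  have hLxy := h.Lxy_nonneg
  have hLy := h.Ly_nonneg
  have htL := h.tLxy_nonneg
  have hr1 := h.rhoxy_nonneg
  have hr2 := h.rhoyy_nonneg
  have e : LPhi S c f g xstar ε = S.Lx + 2 * (S.Lxy * S.tLxy * (1 / c.muy))
      + S.Ly * S.tLxy ^ 2 * (1 / c.muy) ^ 2
      + (S.tLxy * c.rhoyy * (1 / c.muy) ^ 2 + c.rhoxy * (1 / c.muy)) * (1 + S.tLxy / c.muy)
        * ‖gradY f xstar (lowerSol g xstar)‖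
      + 3 * (S.tLxy * c.rhoyy * (1 / c.muy) ^ 2 + c.rhoxy * (1 / c.muy)) * (1 + S.tLxy / c.muy)
        * (S.Lxy + S.Ly * (S.tLxy / c.muy)) * radius c f g xstar ε := by
    rw [LPhi, radius]; ring
  rw [e]
  have hratio := h.ratio_le hY
  have hratio0 : 0 ≤ S.tLxy / c.muy := div_nonneg htL h.muy_pos.le
  set u := 1 / c.muy
  set r := S.tLxy / c.muy
  have hP : S.tLxy * c.rhoyy * u ^ 2 + c.rhoxy * u ≤ Y ^ 5 :=
    calc _ ≤ Y * Y * Y ^ 2 + Y * Y := by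
          gcongr
          exacts [hY.tLxy_le, hY.rhoyy_le, hY.rhoxy_le]
      _ ≤ 2 * Y ^ 4 := by
          nlinarith [pow_le_pow_right₀ (show 1 ≤ Y by linarith) (show 2 ≤ 4 by norm_num)]
      _ ≤ Y ^ 5 := const_mul_pow_le h2 (j := 1) (by norm_num) (by norm_num)
  have hQ : 1 + r ≤ Y ^ 3 :=
    calc 1 + r ≤ Y ^ 2 + Y ^ 2 := add_le_add (one_le_pow₀ (by linarith)) hratio
      _ = 2 * Y ^ 2 := by ring
      _ ≤ Y ^ 3 := const_mul_pow_le h2 (j := 1) (by norm_num) (by norm_num)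
  have hT : S.Lxy + S.Ly * r ≤ Y ^ 4 :=
    calc S.Lxy + S.Ly * r ≤ Y + Y * Y ^ 2 := by
          gcongr
          exacts [hY.Lxy_le, hY.Ly_le]
      _ ≤ 2 * Y ^ 3 := by
          nlinarith [pow_le_pow_right₀ (show 1 ≤ Y by linarith) (show 1 ≤ 3 by norm_num)]
      _ ≤ Y ^ 4 := const_mul_pow_le h2 (j := 1) (by norm_num) (by norm_num)
  have t1 : S.Lx ≤ Y ^ 13 := hY.Lx_le.trans (by
    simpa using pow_le_pow_right₀ (show 1 ≤ Y by linarith) (show 1 ≤ 13 by norm_num))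
  have t2 : 2 * (S.Lxy * S.tLxy * u) ≤ Y ^ 13 :=
    calc 2 * (S.Lxy * S.tLxy * u) ≤ 2 * (Y * Y * Y) := by
          gcongr
          exacts [hY.Lxy_le, hY.tLxy_le]
      _ = 2 * Y ^ 3 := by ring
      _ ≤ Y ^ 13 := const_mul_pow_le h2 (j := 1) (by norm_num) (by norm_num)
  have t3 : S.Ly * S.tLxy ^ 2 * u ^ 2 ≤ Y ^ 13 :=
    calc S.Ly * S.tLxy ^ 2 * u ^ 2 ≤ Y * Y ^ 2 * Y ^ 2 := by
          gcongr
          exacts [hY.Ly_le, hY.tLxy_le]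
      _ = 1 * Y ^ 5 := by ring
      _ ≤ Y ^ 13 := const_mul_pow_le h2 (j := 0) (by norm_num) (by norm_num)
  have t4 : (S.tLxy * c.rhoyy * u ^ 2 + c.rhoxy * u) * (1 + r)
        * ‖gradY f xstar (lowerSol g xstar)‖ ≤ Y ^ 13 :=
    calc _ ≤ Y ^ 5 * Y ^ 3 * Y := by
          gcongr
          exact hY.norm_gradY_le
      _ = 1 * Y ^ 9 := by ring
      _ ≤ Y ^ 13 := const_mul_pow_le h2 (j := 0) (by norm_num) (by norm_num)
  have t5 : 3 * (S.tLxy * c.rhoyy * u ^ 2 + c.rhoxy * u) * (1 + r)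
        * (S.Lxy + S.Ly * r) * radius c f g xstar ε ≤ 8 * Y ^ 13 :=
    calc _ ≤ 3 * Y ^ 5 * Y ^ 3 * Y ^ 4 * (2 * Y) := by gcongr
      _ = 6 * Y ^ 13 := by ring
      _ ≤ 8 * Y ^ 13 := by gcongr; norm_num
  calc _ ≤ 12 * Y ^ 13 := by linarith
    _ ≤ Y ^ 17 := const_mul_pow_le h2 (j := 4) (by norm_num) (by norm_num)

theorem norm_lowerSol_le (h : IsSCSC S c f g xstar) (hY : IsParamBound S c f g xstar ε Y)
    {x : Vec p} (hx : ‖x - xstar‖ ≤ 3 * radius c f g xstar ε) : ‖lowerSol g x‖ ≤ Y ^ 6 := by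
  have h2 := hY.two_le
  have h1 := norm_le_norm_add_norm_sub (lowerSol g xstar) (lowerSol g x)
  rw [norm_sub_rev] at h1
  have h3 := h.norm_lowerSol_sub_le x xstar
  have h4 : S.tLxy / c.muy * ‖x - xstar‖ ≤ Y ^ 2 * (3 * (2 * Y)) := by
    refine mul_le_mul (h.ratio_le hY) (hx.trans ?_) (norm_nonneg _) (by positivity)
    have := h.radius_le hY
    linarith
  have h5 : Y ≤ Y ^ 3 := by
    simpa using pow_le_pow_right₀ (show 1 ≤ Y by linarith) (show 1 ≤ 3 by norm_num)
  calc _ ≤ 7 * Y ^ 3 := by linarith [hY.norm_lowerSol_le]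
    _ ≤ Y ^ 6 := const_mul_pow_le h2 (j := 3) (by norm_num) (by norm_num)

theorem norm_gradY_le (h : IsSCSC S c f g xstar) (hY : IsParamBound S c f g xstar ε Y)
    {x : Vec p} (hx : ‖x - xstar‖ ≤ 3 * radius c f g xstar ε) :
    ‖gradY f x (lowerSol g x)‖ ≤ Y ^ 8 := by
  have h2 := hY.two_le
  have h1 := h.norm_gradY_lowerSol_le x
  have h3 : (S.Lxy + S.Ly * S.tLxy / c.muy) * ‖x - xstar‖ ≤ (Y + Y * Y ^ 2) * (3 * (2 * Y)) := by
    refine mul_le_mul ?_ (hx.trans ?_) (norm_nonneg _) (by positivity)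
    · rw [mul_div_assoc]
      exact add_le_add hY.Lxy_le (mul_le_mul hY.Ly_le (h.ratio_le hY)
        (div_nonneg h.tLxy_nonneg h.muy_pos.le) (by linarith))
    · have := h.radius_le hY
      linarith
  have h4 : Y ≤ Y ^ 4 := by
    simpa using pow_le_pow_right₀ (show 1 ≤ Y by linarith) (show 1 ≤ 4 by norm_num)
  have h5 : Y ^ 2 ≤ Y ^ 4 := pow_le_pow_right₀ (by linarith) (by norm_num)
  calc _ ≤ 16 * Y ^ 4 := by linarith [hY.norm_gradY_le]
    _ ≤ Y ^ 8 := const_mul_pow_le h2 (j := 4) (by norm_num) (by norm_num)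

theorem norm_agd_sub_le (h : IsSCSC S c f g xstar) (hq : 0 < q)
    (hY : IsParamBound S c f g xstar ε Y) {x : Vec p}
    (hx : ‖x - xstar‖ ≤ 3 * radius c f g xstar ε) {N : ℕ} {s : ℝ} (hs0 : 0 ≤ s)
    (hN : (1 - 1 / √c.kappay) ^ N ≤ s ^ 2) :
    ‖(agd c g x N).val - lowerSol g x‖ ≤ s * Y ^ 8 := by
  have h2 := hY.two_le
  have hκ := h.one_le_kappay hq
  have h1 := h.sq_norm_agd_sub_le hq x N
  have h3 : c.kappay + 1 ≤ Y ^ 4 :=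
    calc c.kappay + 1 ≤ Y ^ 2 + Y ^ 2 := add_le_add (h.kappay_le hY) (one_le_pow₀ (by linarith))
      _ = 2 * Y ^ 2 := by ring
      _ ≤ Y ^ 4 := const_mul_pow_le h2 (j := 1) (by norm_num) (by norm_num)
  have h4 : ‖(agd c g x N).val - lowerSol g x‖ ^ 2 ≤ (s * Y ^ 8) ^ 2 :=
    calc _ ≤ _ := h1
      _ ≤ s ^ 2 * (Y ^ 4 * (Y ^ 6) ^ 2) := by
        gcongr
        exact h.norm_lowerSol_le hY hx
      _ = (s * Y ^ 8) ^ 2 := by ring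
  exact (abs_le_of_sq_le_sq' h4 (by positivity)).2

/-- The error of the hypergradient estimate. -/
theorem norm_hypergrad_sub_le (h : IsSCSC S c f g xstar) (hq : 0 < q)
    (hY : IsParamBound S c f g xstar ε Y) {x : Vec p}
    (hx : ‖x - xstar‖ ≤ 3 * radius c f g xstar ε) {N n : ℕ} {s : ℝ} (hs0 : 0 ≤ s) (hs1 : s ≤ 1)
    (hN : (1 - 1 / √c.kappay) ^ N ≤ s ^ 2)
    (hn : (2 * n + 1) * ((√c.kappay - 1) / (√c.kappay + 1)) ^ n ≤ s * Y ^ 6) :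
    ‖(hypergrad c f g N (n + 1) x).val - hyperGradient f g x‖ ≤ s * Y ^ 23 := by
  have h2 := hY.two_le
  have hY1 : 1 ≤ Y := by linarith
  have hd := h.norm_agd_sub_le hq hY hx hs0 hN
  have hB := h.norm_gradY_le hY hx
  have hμ : 0 < 1 / c.muy := one_div_pos.2 h.muy_pos
  have hμY := hY.inv_muy_le
  have hLxy := h.Lxy_nonneg
  have hLy := h.Ly_nonneg
  have htL := h.tLxy_nonneg
  have hr1 := h.rhoxy_nonneg
  have hr2 := h.rhoyy_nonneg
  set y := (agd c g x N).val with hy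
  set y' := lowerSol g x with hy'
  set b := gradY f x y with hb
  set b' := gradY f x y' with hb'
  set v := (heavyBall c g x y b (n + 1)).val with hv
  set vt := hessSolve g x y b with hvt
  set v' := hessSolve g x y' b' with hv'
  -- Four error sources: `∇ₓ f` at the inexact `y`, the heavy-ball residual, the linear system at
  -- `y` instead of `y*(x)`, and the Jacobian at `y` instead of `y*(x)`.
  have hsplit : (hypergrad c f g N (n + 1) x).val - hyperGradient f g x
      = (gradX f x y - gradX f x y')
        - (jacXY g x y (v - vt) + (jacXY g x y (vt - v') + (jacXY g x y - jacXY g x y') v')) := by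
    have : (hypergrad c f g N (n + 1) x).val = gradX f x y - jacXY g x y v := rfl
    rw [this, hyperGradient]
    simp only [sub_apply, map_sub]
    rw [← hy', ← hb', ← hv']
    abel
  have e1 : ‖gradX f x y - gradX f x y'‖ ≤ s * Y ^ 20 :=
    calc _ ≤ S.Lxy * ‖y - y'‖ := h.gradX_f_lip_y x y y'
      _ ≤ Y * (s * Y ^ 8) := by
        gcongr
        exact hY.Lxy_le
      _ = s * Y ^ 9 := by ring
      _ ≤ s * Y ^ 20 := by gcongr; norm_num [hY1]
  have hbb : ‖b - b'‖ ≤ s * Y ^ 9 :=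
    calc _ ≤ S.Ly * ‖y - y'‖ := h.gradY_f_lip_y x y y'
      _ ≤ Y * (s * Y ^ 8) := by
        gcongr
        exact hY.Ly_le
      _ = s * Y ^ 9 := by ring
  have hvt_le : ‖vt‖ ≤ Y ^ 11 :=
    calc ‖vt‖ ≤ ‖b‖ / c.muy := h.norm_hessSolve_le x y b
      _ = ‖b‖ * (1 / c.muy) := div_eq_mul_one_div _ _
      _ ≤ (Y ^ 8 + Y ^ 9) * Y := by
        gcongr
        have := norm_le_norm_add_norm_sub b' b
        rw [norm_sub_rev] at this
        have h3 : s * Y ^ 9 ≤ Y ^ 9 := mul_le_of_le_one_left (by positivity) hs1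
        rw [norm_sub_rev] at hbb
        rw [norm_sub_rev] at this
        linarith
      _ ≤ (Y ^ 9 + Y ^ 9) * Y := by gcongr; norm_num [hY1]
      _ = 2 * Y ^ 10 := by ring
      _ ≤ Y ^ 11 := const_mul_pow_le h2 (j := 1) (by norm_num) (by norm_num)
  have e2 : ‖jacXY g x y (v - vt)‖ ≤ s * Y ^ 20 :=
    calc _ ≤ S.tLxy * ‖v - vt‖ := (jacXY g x y).le_of_opNorm_le (h.norm_jac_le x y) _
      _ ≤ Y * ((s * Y ^ 6) * Y ^ 11) := by
        have := h.norm_heavyBall_sub_le hq x y b n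
        refine mul_le_mul hY.tLxy_le (this.trans ?_) (norm_nonneg _) (by linarith)
        exact mul_le_mul hn hvt_le (norm_nonneg _) (by positivity)
      _ = s * Y ^ 18 := by ring
      _ ≤ s * Y ^ 20 := by gcongr; norm_num [hY1]
  have hv'_le : ‖v'‖ ≤ Y ^ 9 :=
    calc ‖v'‖ ≤ ‖b'‖ / c.muy := h.norm_hessSolve_le x y' b'
      _ = ‖b'‖ * (1 / c.muy) := div_eq_mul_one_div _ _
      _ ≤ Y ^ 8 * Y := by gcongr
      _ = Y ^ 9 := by ring
  have hvv : ‖vt - v'‖ ≤ s * Y ^ 20 := by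
    have h3 := h.norm_hessSolve_sub_le x x y y' b b'
    rw [sub_self, pairNorm_zero_left] at h3
    calc _ ≤ _ := h3
      _ = (‖b - b'‖ + c.rhoyy * ‖y - y'‖ * (‖b'‖ * (1 / c.muy))) * (1 / c.muy) := by ring
      _ ≤ (s * Y ^ 9 + Y * (s * Y ^ 8) * (Y ^ 8 * Y)) * Y := by
        gcongr
        exact hY.rhoyy_le
      _ = s * (Y ^ 10 + Y ^ 19) := by ring
      _ ≤ s * (Y ^ 19 + Y ^ 19) := by gcongr; norm_num [hY1]
      _ = s * (2 * Y ^ 19) := by ring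
      _ ≤ s * Y ^ 20 := by
        gcongr
        exact const_mul_pow_le h2 (j := 1) (by norm_num) (by norm_num)
  have e3 : ‖jacXY g x y (vt - v')‖ ≤ s * Y ^ 21 :=
    calc _ ≤ S.tLxy * ‖vt - v'‖ := (jacXY g x y).le_of_opNorm_le (h.norm_jac_le x y) _
      _ ≤ Y * (s * Y ^ 20) := by
        gcongr
        exact hY.tLxy_le
      _ = s * Y ^ 21 := by ring
  have e4 : ‖(jacXY g x y - jacXY g x y') v'‖ ≤ s * Y ^ 20 := by
    have h3 := h.jacXY_g_lip x x y y'
    rw [sub_self, pairNorm_zero_left] at h3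
    calc _ ≤ c.rhoxy * ‖y - y'‖ * ‖v'‖ := (jacXY g x y - jacXY g x y').le_of_opNorm_le h3 _
      _ ≤ Y * (s * Y ^ 8) * Y ^ 9 := by
        gcongr
        exact hY.rhoxy_le
      _ = s * Y ^ 18 := by ring
      _ ≤ s * Y ^ 20 := by gcongr; norm_num [hY1]
  rw [hsplit]
  calc _ ≤ s * Y ^ 20 + (s * Y ^ 20 + (s * Y ^ 21 + s * Y ^ 20)) :=
        (norm_sub_le _ _).trans (add_le_add e1 ((norm_add_le _ _).trans (add_le_add e2
          ((norm_add_le _ _).trans (add_le_add e3 e4)))))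
    _ = s * (Y ^ 21 + 3 * Y ^ 20) := by ring
    _ ≤ s * (Y ^ 21 + 3 * Y ^ 21) := by gcongr; norm_num [hY1]
    _ = s * (4 * Y ^ 21) := by ring
    _ ≤ s * Y ^ 23 := by
      gcongr
      exact const_mul_pow_le h2 (j := 2) (by norm_num) (by norm_num)

end IsSCSC

/-! ### Numbers of inner iterations and the rate of AccBiO. -/

theorem pow_sub_le_exp {x : ℝ} (hx : x ≤ 1) (n : ℕ) : (1 - x) ^ n ≤ Real.exp (-(n * x)) := by
  have h1 : 1 - x ≤ Real.exp (-x) := by linarith [Real.add_one_le_exp (-x)]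
  calc (1 - x) ^ n ≤ Real.exp (-x) ^ n := pow_le_pow_left₀ (by linarith) h1 n
    _ = Real.exp (-(n * x)) := by rw [← Real.exp_nat_mul]; ring_nf

/-- The power decays like `exp (-n / a)`; half of this exponent pays for the linear factor `2 n +
1`. The bound is written in `n + 1`, the index of the output iterate, and the shift costs `exp (1 /
a) ≤ 3`. -/
theorem heavyBall_factor_le {a : ℝ} (ha : 1 ≤ a) (n : ℕ) :
    (2 * n + 1) * ((a - 1) / (a + 1)) ^ n ≤ 12 * a * Real.exp (-((n + 1) / (2 * a))) := by
  have ha0 : 0 < a := by linarith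
  set t : ℝ := (n + 1) / (2 * a) with ht
  have hfac : (a - 1) / (a + 1) ≤ 1 - 1 / a := by
    rw [div_le_iff₀ (by linarith)]
    have : (1 - 1 / a) * (a + 1) = a - 1 / a := by field_simp; ring
    rw [this]
    have : 1 / a ≤ 1 := (div_le_one ha0).2 ha
    linarith
  have h1 : ((a - 1) / (a + 1)) ^ n ≤ Real.exp (-(n * (1 / a))) :=
    (pow_le_pow_left₀ (div_nonneg (by linarith) (by linarith)) hfac n).trans
      (pow_sub_le_exp ((div_le_one ha0).2 ha) n)
  have h2 : Real.exp (-(n * (1 / a))) ≤ 3 * Real.exp (-(2 * t)) := by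
    have e : -(n * (1 / a)) = 1 / a + -(2 * t) := by rw [ht]; field_simp; ring
    rw [e, Real.exp_add]
    refine mul_le_mul_of_nonneg_right ?_ (Real.exp_pos _).le
    have : Real.exp (1 / a) ≤ Real.exp 1 := Real.exp_le_exp.2 ((div_le_one ha0).2 ha)
    linarith [Real.exp_one_lt_d9]
  have h3 : (2 * n + 1 : ℝ) ≤ 4 * a * Real.exp t := by
    have e : 4 * a * t = 2 * (n + 1) := by rw [ht]; field_simp; ring
    have h4 : t ≤ Real.exp t := by linarith [Real.add_one_le_exp t]
    have h5 : 4 * a * t ≤ 4 * a * Real.exp t := mul_le_mul_of_nonneg_left h4 (by positivity)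
    linarith
  calc _ ≤ (4 * a * Real.exp t) * (3 * Real.exp (-(2 * t))) :=
        mul_le_mul h3 (h1.trans h2)
          (pow_nonneg (div_nonneg (by linarith) (by linarith)) _) (by positivity)
    _ = 12 * a * (Real.exp t * Real.exp (-(2 * t))) := by ring
    _ = 12 * a * Real.exp (-t) := by rw [← Real.exp_add]; ring_nf

/-- The argument of the logarithm in `logFactor`. -/
noncomputable def paramSum {p q : ℕ} (c : CondParams) (f g : Vec p → Vec q → ℝ) (xstar : Vec p)
    (ε : ℝ) : ℝ :=
  2 + 1 / c.mux + 1 / c.muy + c.tLy + c.rhoxy + c.rhoyy + ‖xstar‖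
    + ‖lowerSol g xstar‖ + ‖gradY f xstar (lowerSol g xstar)‖
    + (Phi f g 0 - Phi f g xstar) + ε + 1 / ε

/-- A bound for the constants `S`, at least `1`. -/
noncomputable def constSum (S : SmoothConsts) : ℝ := 1 + |S.Lx| + |S.Lxy| + |S.Ly| + |S.tLxy|

/-- The constant in the number of inner iterations. -/
noncomputable def innerConst (S : SmoothConsts) : ℝ :=
  80 * (1 + Real.log (constSum S) / Real.log 2)

theorem one_le_constSum (S : SmoothConsts) : 1 ≤ constSum S := by
  rw [constSum]
  linarith [abs_nonneg S.Lx, abs_nonneg S.Lxy, abs_nonneg S.Ly, abs_nonneg S.tLxy]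

theorem innerConst_pos (S : SmoothConsts) : 0 < innerConst S := by
  have h1 := Real.log_nonneg (one_le_constSum S)
  have h2 := Real.log_pos one_lt_two
  rw [innerConst]
  positivity

namespace IsSCSC

variable {p q : ℕ} {S : SmoothConsts} {c : CondParams} {f g : Vec p → Vec q → ℝ} {xstar : Vec p}
  {ε Y : ℝ}

theorem gradient_Phi (h : IsSCSC S c f g xstar) (x : Vec p) :
    gradient (Phi f g) x = hyperGradient f g x :=
  (h.hasGradientAt_Phi x).gradient

theorem sq_radius (h : IsSCSC S c f g xstar) (hε : 0 < ε) : radius c f g xstar ε ^ 2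
    = 2 / c.mux * (Phi f g 0 - Phi f g xstar) + ‖xstar‖ ^ 2 + ε / c.mux := by
  have h1 := h.mux_pos
  have h2 := sub_nonneg.2 (h.Phi_xstar_le 0)
  exact Real.sq_sqrt (by positivity)

/-- Strong monotonicity and the Lipschitz bound of `∇Φ` are compared at `0` and `x*`, which are
distinct because `x* ≠ 0`. This gives `κ_x ≥ 1`, needed for the Nesterov parameter. -/
theorem mux_le_LPhi (h : IsSCSC S c f g xstar) (hε : 0 < ε) : c.mux ≤ LPhi S c f g xstar ε := by
  have h1 : ‖(0 : Vec p) - xstar‖ ≤ 3 * radius c f g xstar ε := by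
    rw [zero_sub, norm_neg]
    have h2 : ‖xstar‖ ≤ radius c f g xstar ε := by
      refine Real.le_sqrt_of_sq_le ?_
      have h1 := h.mux_pos
      have h2 := sub_nonneg.2 (h.Phi_xstar_le 0)
      have : 0 ≤ 2 / c.mux * (Phi f g 0 - Phi f g xstar) := by positivity
      have : 0 ≤ ε / c.mux := by positivity
      linarith
    have : 0 ≤ radius c f g xstar ε := Real.sqrt_nonneg _
    linarith
  have h2 := h.norm_hyperGradient_sub_le_LPhi h1 xstar
  have h3 := StrongConvexOn.mul_norm_sub_le h.strongConvex_Phi (h.hasGradientAt_Phi xstar)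
    (h.hasGradientAt_Phi 0)
  have h4 := h3.trans h2
  rw [sub_zero] at h4
  exact le_of_mul_le_mul_right h4 h.xstar_norm_pos

theorem one_le_kappax (h : IsSCSC S c f g xstar) (hε : 0 < ε) : 1 ≤ kappax S c f g xstar ε := by
  rw [kappax, one_le_div h.mux_pos]
  exact h.mux_le_LPhi hε

theorem kappax_le (h : IsSCSC S c f g xstar) (hY : IsParamBound S c f g xstar ε Y) :
    kappax S c f g xstar ε ≤ Y ^ 18 := by
  have h1 : 0 < 1 / c.mux := one_div_pos.2 h.mux_pos
  rw [kappax, div_eq_mul_one_div, pow_succ]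
  exact mul_le_mul (h.LPhi_le hY) hY.inv_mux_le h1.le (pow_nonneg (by linarith [hY.two_le]) _)

/-- The rate of AccBiO, if the inner loops have a sufficiently small error factor `s`. -/
theorem accBiO_rate (h : IsSCSC S c f g xstar) (hq : 0 < q) (hε : 0 < ε)
    (hY : IsParamBound S c f g xstar ε Y) {N n : ℕ} {s : ℝ} (hs0 : 0 ≤ s) (hs : s * Y ^ 40 ≤ 1)
    (hN : (1 - 1 / √c.kappay) ^ N ≤ s ^ 2)
    (hn : (2 * n + 1) * ((√c.kappay - 1) / (√c.kappay + 1)) ^ n ≤ s * Y ^ 6) (k : ℕ) :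
    Phi f g (accBiO c f g (LPhi S c f g xstar ε) N (n + 1) k).val.1 - Phi f g xstar
      ≤ (1 - 1 / √(kappax S c f g xstar ε)) ^ k
        * (Phi f g 0 - Phi f g xstar + c.mux / 2 * ‖xstar‖ ^ 2) + ε / 2
      ∧ ‖(accBiO c f g (LPhi S c f g xstar ε) N (n + 1) k).val.2 - xstar‖
        ≤ 3 * radius c f g xstar ε := by
  have h2 := hY.two_le
  have hY0 : 0 < Y := by linarith
  have hY1 : 1 ≤ Y := by linarith
  have hμ := h.mux_pos
  have hLμ := h.mux_le_LPhi hε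
  have hL : 0 < LPhi S c f g xstar ε := hμ.trans_le hLμ
  have hκ := h.one_le_kappax hε
  have hsκ : 1 ≤ √(kappax S c f g xstar ε) := Real.one_le_sqrt.2 hκ
  have hsκ0 : 0 < √(kappax S c f g xstar ε) := by linarith
  have hs1 : s ≤ 1 := by
    have : s * 1 ≤ s * Y ^ 40 := mul_le_mul_of_nonneg_left (one_le_pow₀ hY1) hs0
    linarith
  set L := LPhi S c f g xstar ε with hLdef
  set R := radius c f g xstar ε with hRdef
  have hR0 : 0 ≤ R := Real.sqrt_nonneg _
  have hR := h.radius_le hY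
  let w : ℕ → Vec p × Vec p := fun k => (accBiO c f g L N (n + 1) k).val
  refine inexact_nesterov_rate (f := Phi f g) (f' := hyperGradient f g) (m := c.mux) (L := L)
    (α := 1 / √(kappax S c f g xstar ε)) (R := R) (δ := s * Y ^ 23) (η := ε / 2) (xs := xstar)
    (x := fun k => (w k).2) (z := fun k => (w k).1)
    (G := fun k => (hypergrad c f g N (n + 1) (w k).2).val) hμ hL (by positivity)
    ((div_le_one hsκ0).2 hsκ) ?_ h.strongConvex_Phi h.hasGradientAt_Phi h.isMin_xstar rfl rfl
    (fun k => rfl) ?_ (by positivity) (by positivity) hR0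
    (fun k hk u => h.norm_hyperGradient_sub_le_LPhi hk u)
    (fun k hk => h.norm_hypergrad_sub_le hq hY hk hs0 hs1 hN hn) ?_ ?_ k
  · rw [div_pow, Real.sq_sqrt (by linarith), kappax, ← hLdef]
    field_simp
  · intro k
    rw [one_sub_div_one_add hsκ0]
    rfl
  · rw [hRdef, h.sq_radius hε]
    refine le_of_eq ?_
    field_simp
  -- The exponent `40` is accounted for here: `23` from the gradient error, `5` from the distances,
  -- `9` from `√κ_x`, `1` from `1 / ε`, and the rest for the factor `2`.
  · have hδ1 : s * Y ^ 23 ≤ 1 :=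
      le_trans (mul_le_mul_of_nonneg_left (pow_le_pow_right₀ hY1 (by norm_num)) hs0) hs
    have hδL : s * Y ^ 23 / L ≤ Y :=
      calc s * Y ^ 23 / L ≤ 1 / c.mux := div_le_div₀ zero_le_one hδ1 hμ hLμ
        _ ≤ Y := hY.inv_mux_le
    have h15 : 7 * R + s * Y ^ 23 / L ≤ Y ^ 5 :=
      calc _ ≤ 15 * Y ^ 1 := by linarith
        _ ≤ Y ^ 5 := const_mul_pow_le h2 (j := 4) (by norm_num) (by norm_num)
    have hκY : √(kappax S c f g xstar ε) ≤ Y ^ 9 := by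
      rw [Real.sqrt_le_left (by positivity), ← pow_mul]
      exact h.kappax_le hY
    have hεY : 1 ≤ ε * Y := by
      have := hY.inv_eps_le
      rwa [div_le_iff₀ hε, mul_comm] at this
    have h28 : s * Y ^ 28 * (2 * Y ^ 9) * Y ≤ 1 :=
      calc s * Y ^ 28 * (2 * Y ^ 9) * Y = s * (2 * Y ^ 38) := by ring
        _ ≤ s * Y ^ 40 := mul_le_mul_of_nonneg_left
            (const_mul_pow_le h2 (j := 1) (by norm_num) (by norm_num)) hs0
        _ ≤ 1 := hs
    have h28' : s * Y ^ 28 * (2 * Y ^ 9) ≤ ε :=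
      le_of_mul_le_mul_right (h28.trans hεY) hY0
    calc s * Y ^ 23 * (7 * R + s * Y ^ 23 / L) ≤ s * Y ^ 23 * Y ^ 5 := by gcongr
      _ = s * Y ^ 28 := by ring
      _ ≤ ε / (2 * √(kappax S c f g xstar ε)) := by
        rw [le_div_iff₀ (by positivity)]
        refine le_trans ?_ h28'
        gcongr
      _ = 1 / √(kappax S c f g xstar ε) * (ε / 2) := by field_simp

theorem two_le_paramSum (h : IsSCSC S c f g xstar) (hε : 0 < ε) :
    2 ≤ paramSum c f g xstar ε := by
  have := h.tLy_nonneg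
  have := h.rhoxy_nonneg
  have := h.rhoyy_nonneg
  have := h.mux_pos
  have := h.muy_pos
  have := sub_nonneg.2 (h.Phi_xstar_le 0)
  have : 0 ≤ 1 / c.mux + 1 / c.muy + c.tLy + c.rhoxy + c.rhoyy + ‖xstar‖
    + ‖lowerSol g xstar‖ + ‖gradY f xstar (lowerSol g xstar)‖
    + (Phi f g 0 - Phi f g xstar) + ε + 1 / ε := by positivity
  rw [paramSum]
  linarith

theorem isParamBound (h : IsSCSC S c f g xstar) (hε : 0 < ε) :
    IsParamBound S c f g xstar ε (constSum S * paramSum c f g xstar ε) := by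
  have a1 := h.tLy_nonneg
  have a2 := h.rhoxy_nonneg
  have a3 := h.rhoyy_nonneg
  have a4 := one_div_pos.2 h.mux_pos
  have a5 := one_div_pos.2 h.muy_pos
  have a6 := sub_nonneg.2 (h.Phi_xstar_le 0)
  have a7 := one_div_pos.2 hε
  have a8 := norm_nonneg xstar
  have a9 := norm_nonneg (lowerSol g xstar)
  have a10 := norm_nonneg (gradY f xstar (lowerSol g xstar))
  have hX := h.two_le_paramSum hε
  have hD := one_le_constSum S
  have key : ∀ u, u ≤ paramSum c f g xstar ε → u ≤ constSum S * paramSum c f g xstar ε :=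
    fun u hu => hu.trans (le_mul_of_one_le_left (by linarith) hD)
  have key' : ∀ u, u ≤ constSum S → u ≤ constSum S * paramSum c f g xstar ε :=
    fun u hu => hu.trans (le_mul_of_one_le_right (by linarith) (by linarith))
  have b1 := le_abs_self S.Lx
  have b2 := le_abs_self S.Lxy
  have b3 := le_abs_self S.Ly
  have b4 := le_abs_self S.tLxy
  have c1 := abs_nonneg S.Lx
  have c2 := abs_nonneg S.Lxy
  have c3 := abs_nonneg S.Ly
  have c4 := abs_nonneg S.tLxy
  constructor
  · exact key _ hX
  · exact key' _ (by rw [constSum]; linarith)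
  · exact key' _ (by rw [constSum]; linarith)
  · exact key' _ (by rw [constSum]; linarith)
  · exact key' _ (by rw [constSum]; linarith)
  all_goals exact key _ (by rw [paramSum]; linarith)

theorem log_two_le_logFactor (h : IsSCSC S c f g xstar) (hε : 0 < ε) :
    Real.log 2 ≤ logFactor c f g xstar ε :=
  Real.log_le_log two_pos (h.two_le_paramSum hε)

/-- The error factor `exp (-c₀ Λ / 2)` beats every power of the parameters that occurs. -/
theorem exp_innerConst_mul_le (h : IsSCSC S c f g xstar) (hε : 0 < ε) :
    Real.exp (-(innerConst S * logFactor c f g xstar ε / 2))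
      * (constSum S * paramSum c f g xstar ε) ^ 40 ≤ 1 := by
  have hX := h.two_le_paramSum hε
  have hD := one_le_constSum S
  have hΛ := h.log_two_le_logFactor hε
  have hl2 := Real.log_pos one_lt_two
  have hY : 0 < constSum S * paramSum c f g xstar ε := by positivity
  rw [← Real.exp_log hY, ← Real.exp_nat_mul, ← Real.exp_add, Real.exp_le_one_iff,
    Real.log_mul (by positivity) (by positivity)]
  have e : Real.log (paramSum c f g xstar ε) = logFactor c f g xstar ε := rfl
  rw [e, innerConst]
  -- As `Λ ≥ log 2`, the logarithm of the fixed constants is a multiple of `Λ`; this explains the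
  -- quotient by `log 2` in `innerConst`.
  have h1 : Real.log (constSum S)
      ≤ Real.log (constSum S) / Real.log 2 * logFactor c f g xstar ε := by
    rw [div_mul_eq_mul_div, le_div_iff₀ hl2]
    exact mul_le_mul_of_nonneg_left hΛ (Real.log_nonneg hD)
  push_cast
  linarith

/-- The error factor is `s = exp (-c₀ Λ / 2)`. The descent rate concerns squared distances and
reaches `s²`; the heavy ball loses half of its exponent and reaches `s` times a power of `Y`. -/
theorem accBiO_rate_of_le (h : IsSCSC S c f g xstar) (hq : 0 < q) (hε : 0 < ε) {N M : ℕ}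
    (hN : innerConst S * √c.kappay * logFactor c f g xstar ε ≤ N)
    (hM : innerConst S * √c.kappay * logFactor c f g xstar ε ≤ M) (k : ℕ) :
    Phi f g (accBiO c f g (LPhi S c f g xstar ε) N M k).val.1 - Phi f g xstar
      ≤ (1 - 1 / √(kappax S c f g xstar ε)) ^ k
        * (Phi f g 0 - Phi f g xstar + c.mux / 2 * ‖xstar‖ ^ 2) + ε / 2
      ∧ ‖(accBiO c f g (LPhi S c f g xstar ε) N M k).val.2 - xstar‖
        ≤ 3 * radius c f g xstar ε := by
  have hκ := h.one_le_kappay hq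
  have hs : 1 ≤ √c.kappay := Real.one_le_sqrt.2 hκ
  have hs0 : 0 < √c.kappay := by linarith
  have hΛ0 : 0 < logFactor c f g xstar ε :=
    (Real.log_pos one_lt_two).trans_le (h.log_two_le_logFactor hε)
  have hc0 := innerConst_pos S
  have hY := h.isParamBound hε
  set Y := constSum S * paramSum c f g xstar ε
  set Λ := logFactor c f g xstar ε
  have hMpos : 0 < M := by
    have : 0 < (M : ℝ) := lt_of_lt_of_le (by positivity) hM
    exact_mod_cast this
  obtain ⟨n, rfl⟩ : ∃ n, M = n + 1 := ⟨M - 1, by omega⟩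
  refine h.accBiO_rate hq hε hY (Real.exp_pos (-(innerConst S * Λ / 2))).le
    (h.exp_innerConst_mul_le hε) ?_ ?_ k
  · refine (pow_sub_le_exp ((div_le_one hs0).2 hs) N).trans ?_
    rw [← Real.exp_nat_mul, Real.exp_le_exp]
    have : innerConst S * Λ ≤ N * (1 / √c.kappay) := by
      rw [mul_one_div, le_div_iff₀ hs0]
      linarith
    push_cast
    linarith
  · refine (heavyBall_factor_le hs n).trans ?_
    have h1 : Real.exp (-((n + 1) / (2 * √c.kappay))) ≤ Real.exp (-(innerConst S * Λ / 2)) := by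
      rw [Real.exp_le_exp, neg_le_neg_iff, le_div_iff₀ (by positivity)]
      push_cast at hM
      linarith
    have h2 : √c.kappay ≤ Y ^ 2 :=
      (Real.sqrt_le_left (pow_nonneg (by linarith [hY.two_le]) 2)).2
        ((h.kappay_le hY).trans (le_self_pow₀ (one_le_pow₀ (by linarith [hY.two_le])) two_ne_zero))
    calc _ ≤ 12 * Y ^ 2 * Real.exp (-(innerConst S * Λ / 2)) := by gcongr
      _ ≤ Y ^ 6 * Real.exp (-(innerConst S * Λ / 2)) := by
        gcongr
        exact const_mul_pow_le hY.two_le (j := 4) (by norm_num) (by norm_num)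
      _ = _ := mul_comm _ _

end IsSCSC

/-! ### The order of `L_Φ` and the complexity. -/

/-- The constant in the upper bound of `L_Φ`. -/
noncomputable def upperConst (S : SmoothConsts) (mubar : ℝ) : ℝ :=
  24 * constSum S ^ 4 * (1 + |mubar|) ^ 2

/-- The constant in the lower bound of `L_Φ`. -/
noncomputable def lowerConst (S : SmoothConsts) : ℝ :=
  1 / (S.Ly * S.tLxy ^ 2) + 1 / (min (S.tLxy ^ 2) S.tLxy * min 1 (S.Ly * S.tLxy))

theorem one_le_upperConst (S : SmoothConsts) (mubar : ℝ) : 1 ≤ upperConst S mubar := by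
  have h1 : 1 ≤ constSum S ^ 4 := one_le_pow₀ (one_le_constSum S)
  have h2 : 1 ≤ (1 + |mubar|) ^ 2 := one_le_pow₀ (by linarith [abs_nonneg mubar])
  rw [upperConst]
  nlinarith

theorem OracleCount.total_accBiO_le {p q : ℕ} (c : CondParams) (f g : Vec p → Vec q → ℝ)
    (L τ : ℝ) {N : ℕ} (hN : 0 < N) (K : ℕ) :
    (accBiO c f g L N N K).count.total τ ≤ K * ((τ + 3) * N) := by
  rw [accBiO_count, OracleCount.total]
  obtain ⟨n, rfl⟩ : ∃ n, N = n + 1 := ⟨N - 1, by omega⟩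
  rw [Nat.add_sub_cancel]
  push_cast
  have : (0 : ℝ) ≤ K * n := by positivity
  nlinarith

namespace IsSCSC

variable {p q : ℕ} {S : SmoothConsts} {c : CondParams} {f g : Vec p → Vec q → ℝ} {xstar : Vec p}
  {ε : ℝ}

theorem radius_eq (h : IsSCSC S c f g xstar) (hε : 0 < ε) :
    radius c f g xstar ε = √(2 * (√(Phi f g 0 - Phi f g xstar) / √c.mux) ^ 2 + ‖xstar‖ ^ 2
      + (√ε / √c.mux) ^ 2) := by
  rw [radius, div_pow, div_pow, Real.sq_sqrt (sub_nonneg.2 (h.Phi_xstar_le 0)),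
    Real.sq_sqrt h.mux_pos.le, Real.sq_sqrt hε.le]
  congr 3
  ring

theorem radius_le_add (h : IsSCSC S c f g xstar) (hε : 0 < ε) : radius c f g xstar ε
    ≤ 2 * (√(Phi f g 0 - Phi f g xstar) / √c.mux + ‖xstar‖ + √ε / √c.mux) := by
  rw [h.radius_eq hε]
  have h1 : 0 ≤ √(Phi f g 0 - Phi f g xstar) / √c.mux := by positivity
  have h2 : 0 ≤ √ε / √c.mux := by positivity
  have h3 := norm_nonneg xstar
  set A := √(Phi f g 0 - Phi f g xstar) / √c.mux
  set E := √ε / √c.mux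
  rw [Real.sqrt_le_left (by positivity)]
  nlinarith [mul_nonneg h1 h2, mul_nonneg h1 h3, mul_nonneg h2 h3]

theorem add_le_radius (h : IsSCSC S c f g xstar) (hε : 0 < ε) :
    √(Phi f g 0 - Phi f g xstar) / √c.mux + ‖xstar‖ + √ε / √c.mux
      ≤ 3 * radius c f g xstar ε := by
  rw [h.radius_eq hε]
  set A := √(Phi f g 0 - Phi f g xstar) / √c.mux
  set E := √ε / √c.mux
  have h1 : A ≤ √(2 * A ^ 2 + ‖xstar‖ ^ 2 + E ^ 2) :=
    Real.le_sqrt_of_sq_le (by nlinarith [sq_nonneg A, sq_nonneg E, sq_nonneg ‖xstar‖])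
  have h2 : ‖xstar‖ ≤ √(2 * A ^ 2 + ‖xstar‖ ^ 2 + E ^ 2) :=
    Real.le_sqrt_of_sq_le (by nlinarith [sq_nonneg A, sq_nonneg E, sq_nonneg ‖xstar‖])
  have h3 : E ≤ √(2 * A ^ 2 + ‖xstar‖ ^ 2 + E ^ 2) :=
    Real.le_sqrt_of_sq_le (by nlinarith [sq_nonneg A, sq_nonneg E, sq_nonneg ‖xstar‖])
  linarith

theorem DeltaStar_add_eq : DeltaStar c f g xstar + √ε / (√c.mux * c.muy)
    = ‖gradY f xstar (lowerSol g xstar)‖ + 1 / c.muy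
      * (√(Phi f g 0 - Phi f g xstar) / √c.mux + ‖xstar‖ + √ε / √c.mux) := by
  rw [DeltaStar, ← div_div, ← div_div]; ring

theorem LPhi_eq : LPhi S c f g xstar ε = S.Lx + 2 * (S.Lxy * S.tLxy * (1 / c.muy))
    + S.Ly * S.tLxy ^ 2 * (1 / c.muy) ^ 2
    + (S.tLxy * c.rhoyy * (1 / c.muy) ^ 2 + c.rhoxy * (1 / c.muy)) * (1 + S.tLxy * (1 / c.muy))
      * (‖gradY f xstar (lowerSol g xstar)‖
        + 3 * ((S.Lxy + S.Ly * S.tLxy * (1 / c.muy)) * radius c f g xstar ε)) := by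
  rw [LPhi, radius]; ring

theorem LPhiOrder_eq : LPhiOrder c f g xstar ε = (1 / c.muy) ^ 2
    + (c.rhoyy * (1 / c.muy) ^ 3 + c.rhoxy * (1 / c.muy) ^ 2)
      * (DeltaStar c f g xstar + √ε / (√c.mux * c.muy)) := by
  rw [LPhiOrder]; ring

theorem DeltaStar_nonneg (h : IsSCSC S c f g xstar) : 0 ≤ DeltaStar c f g xstar := by
  have := h.muy_pos
  rw [DeltaStar]
  positivity

theorem LPhiOrder_nonneg (h : IsSCSC S c f g xstar) : 0 ≤ LPhiOrder c f g xstar ε := by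
  have := h.muy_pos
  have := h.rhoxy_nonneg
  have := h.rhoyy_nonneg
  have := h.DeltaStar_nonneg
  rw [LPhiOrder]
  positivity

theorem LPhi_le_LPhiOrder (h : IsSCSC S c f g xstar) (hε : 0 < ε) {mubar : ℝ}
    (hmu : c.muy ≤ mubar) :
    LPhi S c f g xstar ε ≤ upperConst S mubar * LPhiOrder c f g xstar ε := by
  have hμ := h.muy_pos
  have hLx := h.Lx_nonneg
  have hLxy := h.Lxy_nonneg
  have hLy := h.Ly_nonneg
  have htL := h.tLxy_nonneg
  have hr1 := h.rhoxy_nonneg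
  have hr2 := h.rhoyy_nonneg
  have hR := h.radius_le_add hε
  have hR0 : 0 ≤ radius c f g xstar ε := Real.sqrt_nonneg _
  rw [LPhi_eq, LPhiOrder_eq, DeltaStar_add_eq, upperConst]
  have hD := one_le_constSum S
  have hDe : constSum S = 1 + S.Lx + S.Lxy + S.Ly + S.tLxy := by
    rw [constSum, abs_of_nonneg hLx, abs_of_nonneg hLxy, abs_of_nonneg hLy, abs_of_nonneg htL]
  set D := constSum S
  set W := 1 + |mubar| with hW
  have hW1 : 1 ≤ W := by rw [hW]; linarith [abs_nonneg mubar]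
  set u := 1 / c.muy with hu
  have hu0 : 0 < u := one_div_pos.2 hμ
  -- The bound on `μ_y` enters here: lower powers of `1 / μ_y` can be raised to higher ones at the
  -- price of a factor `W`.
  have hWu : 1 ≤ W * u := by
    rw [hu, mul_one_div, one_le_div hμ, hW]
    linarith [le_abs_self mubar]
  have hA : 0 ≤ √(Phi f g 0 - Phi f g xstar) / √c.mux + ‖xstar‖ + √ε / √c.mux := by positivity
  set V := √(Phi f g 0 - Phi f g xstar) / √c.mux + ‖xstar‖ + √ε / √c.mux
  set B := ‖gradY f xstar (lowerSol g xstar)‖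
  have hB : 0 ≤ B := norm_nonneg _
  have l1 : S.Lx ≤ D := by linarith
  have l2 : S.Lxy ≤ D := by linarith
  have l3 : S.Ly ≤ D := by linarith
  have l4 : S.tLxy ≤ D := by linarith
  have hD3 : D ≤ D ^ 3 := le_self_pow₀ hD (by norm_num)
  have hD2 : D ^ 2 ≤ D ^ 3 := pow_le_pow_right₀ hD (by norm_num)
  have hD1 : D ≤ D ^ 2 := le_self_pow₀ hD (by norm_num)
  have t1 : S.Lx ≤ D ^ 3 * W ^ 2 * u ^ 2 :=
    calc S.Lx ≤ D ^ 3 * 1 := by linarith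
      _ ≤ D ^ 3 * (W * u) ^ 2 := by gcongr; exact one_le_pow₀ hWu
      _ = _ := by ring
  have t2 : S.Lxy * S.tLxy * u ≤ D ^ 3 * W ^ 2 * u ^ 2 :=
    calc S.Lxy * S.tLxy * u ≤ D * D * u * 1 := by rw [mul_one]; gcongr
      _ ≤ D * D * u * (W * u) := by gcongr
      _ = D ^ 2 * (W * 1) * u ^ 2 := by ring
      _ ≤ D ^ 3 * (W * W) * u ^ 2 := by gcongr
      _ = _ := by ring
  have t3 : S.Ly * S.tLxy ^ 2 * u ^ 2 ≤ D ^ 3 * W ^ 2 * u ^ 2 :=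
    calc S.Ly * S.tLxy ^ 2 * u ^ 2 ≤ D * D ^ 2 * u ^ 2 * 1 := by rw [mul_one]; gcongr
      _ ≤ D * D ^ 2 * u ^ 2 * W ^ 2 := by gcongr; exact one_le_pow₀ hW1
      _ = _ := by ring
  have hWDu : ∀ {a : ℝ}, 0 ≤ a → a ≤ D → ∀ {b : ℝ}, b ≤ D ^ 2 → a + b * u ≤ 2 * D ^ 2 * W * u := by
    intro a ha0 ha b hb
    have h1 : a * 1 ≤ D ^ 2 * (W * u) := mul_le_mul (ha.trans hD1) hWu zero_le_one (by positivity)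
    have h2 : b * u ≤ D ^ 2 * u * W := by
      have : b * u ≤ D ^ 2 * u := mul_le_mul_of_nonneg_right hb hu0.le
      exact this.trans (le_mul_of_one_le_right (by positivity) hW1)
    linarith
  have hP1 : 1 + S.tLxy * u ≤ 2 * D * W * u := by
    have h1 : 1 * 1 ≤ D * (W * u) := mul_le_mul hD hWu zero_le_one (by linarith)
    have h2 : S.tLxy * u ≤ D * u * W :=
      (mul_le_mul_of_nonneg_right l4 hu0.le).trans
        (le_mul_of_one_le_right (by positivity) hW1)
    linarith
  have hP2 : S.tLxy * c.rhoyy * u ^ 2 + c.rhoxy * u ≤ D * (c.rhoyy * u ^ 2 + c.rhoxy * u) :=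
    calc _ ≤ D * c.rhoyy * u ^ 2 + 1 * (c.rhoxy * u) := by rw [one_mul]; gcongr
      _ ≤ D * c.rhoyy * u ^ 2 + D * (c.rhoxy * u) := by gcongr
      _ = _ := by ring
  have hbr : B + 3 * ((S.Lxy + S.Ly * S.tLxy * u) * radius c f g xstar ε)
      ≤ 12 * D ^ 2 * W * (B + u * V) := by
    have h1 : S.Lxy + S.Ly * S.tLxy * u ≤ 2 * D ^ 2 * W * u :=
      hWDu hLxy l2 (by rw [sq]; gcongr)
    have h2 : (S.Lxy + S.Ly * S.tLxy * u) * radius c f g xstar ε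
        ≤ 2 * D ^ 2 * W * u * (2 * V) := by gcongr
    have h3 : 1 ≤ 12 * D ^ 2 * W := by
      have : 1 ≤ D ^ 2 * W := one_le_mul_of_one_le_of_one_le (one_le_pow₀ hD) hW1
      linarith
    have h4 := le_mul_of_one_le_left hB h3
    linarith
  have hQ : 0 ≤ (c.rhoyy * u ^ 3 + c.rhoxy * u ^ 2) * (B + u * V) := by positivity
  have t4 : (S.tLxy * c.rhoyy * u ^ 2 + c.rhoxy * u) * (1 + S.tLxy * u)
      * (B + 3 * ((S.Lxy + S.Ly * S.tLxy * u) * radius c f g xstar ε))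
      ≤ 24 * D ^ 4 * W ^ 2 * ((c.rhoyy * u ^ 3 + c.rhoxy * u ^ 2) * (B + u * V)) :=
    calc _ ≤ (D * (c.rhoyy * u ^ 2 + c.rhoxy * u)) * (2 * D * W * u)
          * (12 * D ^ 2 * W * (B + u * V)) := by gcongr
      _ = _ := by ring
  have t5 : 4 * (D ^ 3 * W ^ 2 * u ^ 2) ≤ 24 * D ^ 4 * W ^ 2 * u ^ 2 :=
    calc 4 * (D ^ 3 * W ^ 2 * u ^ 2) ≤ 24 * (D ^ 4 * W ^ 2 * u ^ 2) := by
          gcongr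
          · norm_num
          · norm_num
      _ = _ := by ring
  linarith

theorem LPhiOrder_le_LPhi (h : IsSCSC S c f g xstar) (hε : 0 < ε) (hLy : 0 < S.Ly)
    (htL : 0 < S.tLxy) :
    LPhiOrder c f g xstar ε ≤ lowerConst S * LPhi S c f g xstar ε := by
  have hμ := h.muy_pos
  have hLx := h.Lx_nonneg
  have hLxy := h.Lxy_nonneg
  have hr1 := h.rhoxy_nonneg
  have hr2 := h.rhoyy_nonneg
  have hR := h.add_le_radius hε
  have hR0 : 0 ≤ radius c f g xstar ε := Real.sqrt_nonneg _
  rw [LPhi_eq, LPhiOrder_eq, DeltaStar_add_eq, lowerConst]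
  set u := 1 / c.muy with hu
  have hu0 : 0 < u := one_div_pos.2 hμ
  have hV : 0 ≤ √(Phi f g 0 - Phi f g xstar) / √c.mux + ‖xstar‖ + √ε / √c.mux := by positivity
  set V := √(Phi f g 0 - Phi f g xstar) / √c.mux + ‖xstar‖ + √ε / √c.mux
  set B := ‖gradY f xstar (lowerSol g xstar)‖
  have hB : 0 ≤ B := norm_nonneg _
  set k₁ := min (S.tLxy ^ 2) S.tLxy with hk₁
  set k₂ := min 1 (S.Ly * S.tLxy) with hk₂
  have hk₁0 : 0 < k₁ := lt_min (by positivity) htL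
  have hk₂0 : 0 < k₂ := lt_min one_pos (by positivity)
  have b1 : k₁ ≤ S.tLxy ^ 2 := min_le_left _ _
  have b2 : k₁ ≤ S.tLxy := min_le_right _ _
  have b3 : k₂ ≤ 1 := min_le_left _ _
  have b4 : k₂ ≤ S.Ly * S.tLxy := min_le_right _ _
  -- From `1 + L̃_xy u` only the second summand is kept, which supplies the extra power of `u`.
  have hP : k₁ * (c.rhoyy * u ^ 3 + c.rhoxy * u ^ 2)
      ≤ (S.tLxy * c.rhoyy * u ^ 2 + c.rhoxy * u) * (1 + S.tLxy * u) :=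
    calc _ = k₁ * (c.rhoyy * u ^ 3) + k₁ * (c.rhoxy * u ^ 2) := by ring
      _ ≤ S.tLxy ^ 2 * (c.rhoyy * u ^ 3) + S.tLxy * (c.rhoxy * u ^ 2) := by gcongr
      _ = (S.tLxy * c.rhoyy * u ^ 2 + c.rhoxy * u) * (0 + S.tLxy * u) := by ring
      _ ≤ _ := by gcongr; exact zero_le_one (α := ℝ)
  have hbr : k₂ * (B + u * V)
      ≤ B + 3 * ((S.Lxy + S.Ly * S.tLxy * u) * radius c f g xstar ε) :=
    calc _ = k₂ * B + k₂ * (u * V) := by ring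
      _ ≤ 1 * B + S.Ly * S.tLxy * (u * (3 * radius c f g xstar ε)) := by gcongr
      _ = B + 3 * ((0 + S.Ly * S.tLxy * u) * radius c f g xstar ε) := by ring
      _ ≤ _ := by gcongr
  have hmul : k₁ * k₂ * ((c.rhoyy * u ^ 3 + c.rhoxy * u ^ 2) * (B + u * V))
      ≤ (S.tLxy * c.rhoyy * u ^ 2 + c.rhoxy * u) * (1 + S.tLxy * u)
        * (B + 3 * ((S.Lxy + S.Ly * S.tLxy * u) * radius c f g xstar ε)) :=
    calc _ = k₁ * (c.rhoyy * u ^ 3 + c.rhoxy * u ^ 2) * (k₂ * (B + u * V)) := by ring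
      _ ≤ _ := by gcongr
  have hrest : 0 ≤ (S.tLxy * c.rhoyy * u ^ 2 + c.rhoxy * u) * (1 + S.tLxy * u)
        * (B + 3 * ((S.Lxy + S.Ly * S.tLxy * u) * radius c f g xstar ε)) := by positivity
  set Z := (S.tLxy * c.rhoyy * u ^ 2 + c.rhoxy * u) * (1 + S.tLxy * u)
        * (B + 3 * ((S.Lxy + S.Ly * S.tLxy * u) * radius c f g xstar ε))
  have h0 : 0 ≤ S.Lxy * S.tLxy * u := by positivity
  have h0' : 0 ≤ S.Ly * S.tLxy ^ 2 * u ^ 2 := by positivity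
  rw [add_mul (1 / (S.Ly * S.tLxy ^ 2))]
  refine add_le_add ?_ ?_
  · rw [one_div_mul_eq_div (S.Ly * S.tLxy ^ 2), le_div_iff₀ (by positivity)]
    linarith
  · rw [one_div_mul_eq_div (k₁ * k₂), le_div_iff₀ (by positivity)]
    linarith

/-- The product of the condition numbers, if `ε` is at most the initial gap. -/
theorem sqrt_kappax_mul_sqrt_kappay_le (h : IsSCSC S c f g xstar) (hε : 0 < ε) {mubar : ℝ}
    (hmu : c.muy ≤ mubar) (hgap : ε ≤ Phi f g 0 - Phi f g xstar) :
    √(kappax S c f g xstar ε) * √c.kappay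
      ≤ 2 * upperConst S mubar * complexityOrder c f g xstar := by
  have hμx := h.mux_pos
  have hμ := h.muy_pos
  have htLy := h.tLy_nonneg
  have hr1 := h.rhoxy_nonneg
  have hr2 := h.rhoyy_nonneg
  have hΔ := h.DeltaStar_nonneg
  have hC := one_le_upperConst S mubar
  have hL := h.LPhi_le_LPhiOrder hε hmu
  have hL0 : 0 < LPhi S c f g xstar ε := hμx.trans_le (h.mux_le_LPhi hε)
  set C := upperConst S mubar
  have hE : √ε / (√c.mux * c.muy) ≤ DeltaStar c f g xstar := by
    have h1 : √ε / (√c.mux * c.muy) ≤ √(Phi f g 0 - Phi f g xstar) / (√c.mux * c.muy) := by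
      gcongr
    have h2 : 0 ≤ ‖gradY f xstar (lowerSol g xstar)‖ + ‖xstar‖ / c.muy := by positivity
    rw [DeltaStar]
    linarith
  set Δ := DeltaStar c f g xstar with hΔdef
  have hT : LPhiOrder c f g xstar ε
      ≤ 2 * (1 / c.muy ^ 2 + (c.rhoyy / c.muy ^ 3 + c.rhoxy / c.muy ^ 2) * Δ) := by
    have h1 : (c.rhoyy / c.muy ^ 3 + c.rhoxy / c.muy ^ 2) * (Δ + √ε / (√c.mux * c.muy))
        ≤ (c.rhoyy / c.muy ^ 3 + c.rhoxy / c.muy ^ 2) * (Δ + Δ) := by gcongr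
    have h2 : 0 ≤ 1 / c.muy ^ 2 := by positivity
    rw [LPhiOrder]
    linarith
  have hL2 : LPhi S c f g xstar ε
      ≤ C * (2 * (1 / c.muy ^ 2 + (c.rhoyy / c.muy ^ 3 + c.rhoxy / c.muy ^ 2) * Δ)) :=
    hL.trans (mul_le_mul_of_nonneg_left hT (by linarith))
  have hCO : 0 ≤ complexityOrder c f g xstar := by rw [complexityOrder]; positivity
  -- A sum of squares is at most the square of the sum; this lets `κ_x κ_y` be bounded before roots
  -- are taken.
  have hsum : c.tLy / (c.mux * c.muy ^ 3) + c.rhoyy * c.tLy / (c.mux * c.muy ^ 4) * Δ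
      + c.rhoxy * c.tLy / (c.mux * c.muy ^ 3) * Δ ≤ complexityOrder c f g xstar ^ 2 := by
    rw [complexityOrder, ← hΔdef]
    have s1 := Real.sq_sqrt (show 0 ≤ c.tLy / (c.mux * c.muy ^ 3) by positivity)
    have s2 := Real.sq_sqrt (show 0 ≤ c.rhoyy * c.tLy / (c.mux * c.muy ^ 4) by positivity)
    have s3 := Real.sq_sqrt (show 0 ≤ c.rhoxy * c.tLy / (c.mux * c.muy ^ 3) by positivity)
    have s4 := Real.sq_sqrt hΔ
    have n1 := Real.sqrt_nonneg (c.tLy / (c.mux * c.muy ^ 3))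
    have n2 := Real.sqrt_nonneg (c.rhoyy * c.tLy / (c.mux * c.muy ^ 4))
    have n3 := Real.sqrt_nonneg (c.rhoxy * c.tLy / (c.mux * c.muy ^ 3))
    have n4 := Real.sqrt_nonneg Δ
    set a := √(c.tLy / (c.mux * c.muy ^ 3))
    set b := √(c.rhoyy * c.tLy / (c.mux * c.muy ^ 4))
    set d := √(c.rhoxy * c.tLy / (c.mux * c.muy ^ 3))
    rw [← s1, ← s2, ← s3]
    conv_lhs => rw [← s4]
    have e : (a + (b + d) * √Δ) ^ 2 = a ^ 2 + b ^ 2 * √Δ ^ 2 + d ^ 2 * √Δ ^ 2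
        + 2 * (a * b * √Δ + a * d * √Δ + b * d * √Δ ^ 2) := by ring
    have : 0 ≤ a * b * √Δ + a * d * √Δ + b * d * √Δ ^ 2 := by positivity
    linarith
  have hsq : (√(kappax S c f g xstar ε) * √c.kappay) ^ 2
      ≤ (2 * C * complexityOrder c f g xstar) ^ 2 := by
    rw [mul_pow, Real.sq_sqrt (by rw [kappax]; positivity),
      Real.sq_sqrt (by rw [CondParams.kappay]; positivity)]
    calc kappax S c f g xstar ε * c.kappay
        = LPhi S c f g xstar ε * (c.tLy / (c.mux * c.muy)) := by
          rw [kappax, CondParams.kappay]; field_simp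
      _ ≤ C * (2 * (1 / c.muy ^ 2 + (c.rhoyy / c.muy ^ 3 + c.rhoxy / c.muy ^ 2) * Δ))
          * (c.tLy / (c.mux * c.muy)) := by gcongr
      _ = 2 * C * (c.tLy / (c.mux * c.muy ^ 3) + c.rhoyy * c.tLy / (c.mux * c.muy ^ 4) * Δ
          + c.rhoxy * c.tLy / (c.mux * c.muy ^ 3) * Δ) := by field_simp; ring
      _ ≤ 2 * C * complexityOrder c f g xstar ^ 2 := by gcongr
      _ ≤ (2 * C) ^ 2 * complexityOrder c f g xstar ^ 2 := by
          gcongr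
          exact le_self_pow₀ (by linarith) two_ne_zero
      _ = _ := by ring
  exact (abs_le_of_sq_le_sq' hsq (by positivity)).2

/-- The complexity of AccBiO. -/
theorem exists_accBiO_lt (h : IsSCSC S c f g xstar) (hq : 0 < q) (hε : 0 < ε) {mubar τ : ℝ}
    (hmu : c.muy ≤ mubar) (hτ : 0 < τ) {N : ℕ}
    (hN : N = ⌈innerConst S * √c.kappay * logFactor c f g xstar ε⌉₊) :
    ∃ K : ℕ, Phi f g (accBiO c f g (LPhi S c f g xstar ε) N N K).val.1 - Phi f g xstar < ε ∧
      (accBiO c f g (LPhi S c f g xstar ε) N N K).count.total τ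
        ≤ 14 * upperConst S mubar * (τ + 3) * (innerConst S + 2) * complexityOrder c f g xstar
          * logFactor c f g xstar ε ^ 2 := by
  have hC := one_le_upperConst S mubar
  have hc0 := innerConst_pos S
  have hCO : 0 ≤ complexityOrder c f g xstar := by rw [complexityOrder]; positivity
  -- If the initial gap is already below `ε`, then `K = 0` works at no cost. Otherwise `ε` can be
  -- dropped from the order of `L_Φ`.
  rcases lt_or_ge (Phi f g 0 - Phi f g xstar) ε with hgap | hgap
  · refine ⟨0, hgap, ?_⟩
    rw [accBiO_count]
    simp only [OracleCount.total, zero_mul, Nat.cast_zero, add_zero, mul_zero]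
    positivity
  have hl2 : 0.69 < Real.log 2 := by linarith [Real.log_two_gt_d9]
  have hΛ := h.log_two_le_logFactor hε
  have hX := h.two_le_paramSum hε
  have hΛX : Real.exp (logFactor c f g xstar ε) = paramSum c f g xstar ε :=
    Real.exp_log (two_pos.trans_le hX)
  set Λ := logFactor c f g xstar ε
  set X := paramSum c f g xstar ε with hXdef
  have hΛ0 : 0 < Λ := by linarith
  have hκx : 1 ≤ √(kappax S c f g xstar ε) := Real.one_le_sqrt.2 (h.one_le_kappax hε)
  have hκy : 1 ≤ √c.kappay := Real.one_le_sqrt.2 (h.one_le_kappay hq)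
  set κ := √(kappax S c f g xstar ε) with hκ
  have hNle : innerConst S * √c.kappay * Λ ≤ N := by rw [hN]; exact Nat.le_ceil _
  have hN0 : 0 < N := by
    have : 0 < (N : ℝ) := lt_of_lt_of_le (by positivity) hNle
    exact_mod_cast this
  have hNup : (N : ℝ) ≤ (innerConst S + 2) * (√c.kappay * Λ) := by
    have h1 : (N : ℝ) < innerConst S * √c.kappay * Λ + 1 := by
      rw [hN]; exact Nat.ceil_lt_add_one (by positivity)
    have h2 : Λ ≤ √c.kappay * Λ := le_mul_of_one_le_left hΛ0.le hκy
    linarith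
  -- The ceiling costs `1 ≤ 2 Λ ≤ 2 κ Λ`, by `Λ ≥ log 2 > 0.69`.
  have hK : (⌈5 * κ * Λ⌉₊ : ℝ) ≤ 7 * (κ * Λ) := by
    have h1 : (⌈5 * κ * Λ⌉₊ : ℝ) < 5 * κ * Λ + 1 := Nat.ceil_lt_add_one (by positivity)
    have h2 : Λ ≤ κ * Λ := le_mul_of_one_le_left hΛ0.le hκx
    linarith
  refine ⟨⌈5 * κ * Λ⌉₊, ?_, ?_⟩
  · have hrate := (h.accBiO_rate_of_le hq hε hNle hNle ⌈5 * κ * Λ⌉₊).1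
    refine hrate.trans_lt ?_
    have hκ0 : 0 < κ := by linarith
    -- Since `X = exp Λ`, this choice of `K` yields `X⁻⁵`. By quadratic growth the initial Lyapunov
    -- value is at most `2 X`, and the product is less than `1 / (2 X) ≤ ε / 2`.
    have h1 : (1 - 1 / κ) ^ ⌈5 * κ * Λ⌉₊ ≤ 1 / X ^ 5 := by
      refine (pow_sub_le_exp ((div_le_one hκ0).2 hκx) _).trans ?_
      rw [← hΛX, ← Real.exp_nat_mul, one_div (Real.exp _), ← Real.exp_neg, Real.exp_le_exp,
        neg_le_neg_iff, mul_one_div, le_div_iff₀ hκ0]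
      have := Nat.le_ceil (5 * κ * Λ)
      push_cast
      linarith
    have hgrow := StrongConvexOn.add_sq_norm_le h.strongConvex_Phi h.isMin_xstar 0
    rw [zero_sub, norm_neg] at hgrow
    have a1 := h.tLy_nonneg
    have a2 := h.rhoxy_nonneg
    have a3 := h.rhoyy_nonneg
    have a4 := one_div_pos.2 h.mux_pos
    have a5 := one_div_pos.2 h.muy_pos
    have a7 := one_div_pos.2 hε
    have a8 := norm_nonneg xstar
    have a9 := norm_nonneg (lowerSol g xstar)
    have a10 := norm_nonneg (gradY f xstar (lowerSol g xstar))
    have hgX : Phi f g 0 - Phi f g xstar ≤ X := by rw [hXdef, paramSum]; linarith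
    have hεX : 1 / ε ≤ X := by
      rw [hXdef, paramSum]
      linarith
    have hεX' : 1 / X ≤ ε := by
      rw [div_le_iff₀ (by linarith)]
      rwa [div_le_iff₀ hε, mul_comm] at hεX
    have h2 : (1 - 1 / κ) ^ ⌈5 * κ * Λ⌉₊
        * (Phi f g 0 - Phi f g xstar + c.mux / 2 * ‖xstar‖ ^ 2) ≤ 1 / X ^ 5 * (2 * X) := by
      have hμx := h.mux_pos
      refine mul_le_mul h1 (by linarith) ?_ (by positivity)
      have : 0 ≤ c.mux / 2 * ‖xstar‖ ^ 2 := by positivity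
      linarith
    have h3 : 1 / X ^ 5 * (2 * X) < 1 / X / 2 := by
      have hX0 : 0 < X := by linarith
      have e : 1 / X ^ 5 * (2 * X) = 1 / X * (2 / X ^ 3) := by field_simp
      have h8 : (2 : ℝ) ^ 3 ≤ X ^ 3 := pow_le_pow_left₀ (by norm_num) hX 3
      have h9 : 2 / X ^ 3 < 1 / 2 := by
        rw [div_lt_div_iff₀ (by positivity) two_pos]
        linarith
      have h10 : 0 < 1 / X := by positivity
      rw [e]
      nlinarith
    linarith
  · refine (OracleCount.total_accBiO_le c f g _ τ hN0 _).trans ?_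
    have hκκ := h.sqrt_kappax_mul_sqrt_kappay_le hε hmu hgap
    calc (⌈5 * κ * Λ⌉₊ : ℝ) * ((τ + 3) * N)
        ≤ 7 * (κ * Λ) * ((τ + 3) * ((innerConst S + 2) * (√c.kappay * Λ))) := by gcongr
      _ = 7 * (τ + 3) * (innerConst S + 2) * Λ ^ 2 * (κ * √c.kappay) := by ring
      _ ≤ 7 * (τ + 3) * (innerConst S + 2) * Λ ^ 2
          * (2 * upperConst S mubar * complexityOrder c f g xstar) := by gcongr
      _ = _ := by ring

end IsSCSC

end Bilevel

/-! ### Assembly of the theorem. -/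

theorem theorem3 (S : Bilevel.SmoothConsts) (mubar τ : ℝ) (hτ : 0 < τ) :
    ∃ c₀ C : ℝ, 0 < c₀ ∧ 0 < C ∧
      ∀ (p q : ℕ) (_ : 0 < q) (f g : Bilevel.Vec p → Bilevel.Vec q → ℝ)
        (xstar : Bilevel.Vec p) (c : Bilevel.CondParams) (ε : ℝ),
        Bilevel.IsSCSC S c f g xstar → c.muy ≤ mubar → 0 < ε →
        -- the order of `L_Φ`
        (Bilevel.LPhi S c f g xstar ε ≤ C * Bilevel.LPhiOrder c f g xstar ε ∧
          (0 < S.Ly → 0 < S.tLxy →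
            Bilevel.LPhiOrder c f g xstar ε ≤ C * Bilevel.LPhi S c f g xstar ε)) ∧
        -- smoothness of `Φ` at the iterates `x_k`, and the convergence rate
        (∀ N M : ℕ,
          c₀ * Real.sqrt c.kappay * Bilevel.logFactor c f g xstar ε ≤ N →
          c₀ * Real.sqrt c.kappay * Bilevel.logFactor c f g xstar ε ≤ M →
          Differentiable ℝ (Bilevel.Phi f g) ∧
          (∀ (k : ℕ) (x : Bilevel.Vec p),
            ‖gradient (Bilevel.Phi f g) x - gradient (Bilevel.Phi f g)
                (Bilevel.accBiO c f g (Bilevel.LPhi S c f g xstar ε) N M k).val.2‖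
              ≤ Bilevel.LPhi S c f g xstar ε
                * ‖x - (Bilevel.accBiO c f g (Bilevel.LPhi S c f g xstar ε) N M k).val.2‖) ∧
          ∀ K : ℕ,
            Bilevel.Phi f g (Bilevel.accBiO c f g (Bilevel.LPhi S c f g xstar ε) N M K).val.1
                - Bilevel.Phi f g xstar
              ≤ (1 - 1 / Real.sqrt (Bilevel.kappax S c f g xstar ε)) ^ K
                  * (Bilevel.Phi f g 0 - Bilevel.Phi f g xstar + c.mux / 2 * ‖xstar‖ ^ 2)
                + ε / 2) ∧
        -- the complexity of finding an `ε`-approximate solution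
        (∃ N M K : ℕ,
          N = ⌈c₀ * Real.sqrt c.kappay * Bilevel.logFactor c f g xstar ε⌉₊ ∧
          M = ⌈c₀ * Real.sqrt c.kappay * Bilevel.logFactor c f g xstar ε⌉₊ ∧
          Bilevel.Phi f g (Bilevel.accBiO c f g (Bilevel.LPhi S c f g xstar ε) N M K).val.1
              - Bilevel.Phi f g xstar < ε ∧
          (Bilevel.accBiO c f g (Bilevel.LPhi S c f g xstar ε) N M K).count.total τ
            ≤ C * Bilevel.complexityOrder c f g xstar
                * Bilevel.logFactor c f g xstar ε ^ 2) := by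
  obtain ⟨hc₀, hC₁⟩ := And.intro (Bilevel.innerConst_pos S) (Bilevel.one_le_upperConst S mubar)
  set C₁ := Bilevel.upperConst S mubar with hC₁def
  -- The constants are fixed before `S` is known to have nonnegative entries, so `lowerConst S` may
  -- have either sign; the absolute value keeps the sum positive.
  set C₂ := |Bilevel.lowerConst S| with hC₂
  set C₃ := 14 * C₁ * (τ + 3) * (Bilevel.innerConst S + 2) with hC₃
  have hC₂0 : 0 ≤ C₂ := abs_nonneg _
  have hC₃0 : 0 ≤ C₃ := by positivity
  refine ⟨Bilevel.innerConst S, C₁ + C₂ + C₃, hc₀, by linarith, ?_⟩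
  intro p q hq f g xstar c ε h hmu hε
  have hT := h.LPhiOrder_nonneg (ε := ε)
  have hL : 0 < Bilevel.LPhi S c f g xstar ε := h.mux_pos.trans_le (h.mux_le_LPhi hε)
  refine ⟨⟨?_, fun hLy htL => ?_⟩, fun N M hN hM => ⟨?_, ?_, ?_⟩, ?_⟩
  · exact (h.LPhi_le_LPhiOrder hε hmu).trans (mul_le_mul_of_nonneg_right (by linarith) hT)
  · refine (h.LPhiOrder_le_LPhi hε hLy htL).trans (mul_le_mul_of_nonneg_right ?_ hL.le)
    linarith [le_abs_self (Bilevel.lowerConst S)]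
  · exact fun x => (h.hasGradientAt_Phi x).differentiableAt
  · intro k x
    rw [h.gradient_Phi, h.gradient_Phi]
    exact h.norm_hyperGradient_sub_le_LPhi (h.accBiO_rate_of_le hq hε hN hM k).2 x
  · exact fun K => (h.accBiO_rate_of_le hq hε hN hM K).1
  · obtain ⟨K, hK, hcost⟩ := h.exists_accBiO_lt hq hε hmu hτ rfl
    refine ⟨_, _, K, rfl, rfl, hK, hcost.trans ?_⟩
    have hCO : 0 ≤ Bilevel.complexityOrder c f g xstar := by
      rw [Bilevel.complexityOrder]; positivity
    gcongr
    linarith
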